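/- For $n \ge 1$ let $M_{\mathsf{count}} \in \{0,1\}^{n\times n}$ be the lower-triangular all-ones matrix, $M_{\mathsf{count}}[i,j] = 1$ if $i \ge j$ and $0$ otherwise. For a real matrix $A$ let $\|A\|_{p\to q} = \max_{x \ne 0} \|Ax\|_q/\|x\|_p$, let $\|A\|_F$ be the Frobenius norm, and for $A \in \mathbb{R}^{n\times n}$ let $$\gamma_2(A) = \min_{A = LR} \|L\|_{2\to\infty}\|R\|_{1\to 2}, \qquad \gamma_F(A) = \min_{A = LR} \tfrac{1}{\sqrt n}\|L\|_F\|R\|_{1\to 2},$$ where $L \in \mathbb{R}^{n\times k}$, $R\in\mathbb{R}^{k\times n}$ and $k$ is arbitrary. Let $C$ be the lower-triangular Toeplitz matrix with entries $C_{ij} = 4^{-(i-j)}\binom{2(i-j)}{i-j}$ for $i \ge j$ and $0$ for $i<j$, let $D$ be the diagonal matrix whose entries are the Euclidean norms of the columns of $C$, and put $$R = C D^{-1}, \qquad L = M_{\mathsf{count}} R^{-1} = M_{\mathsf{count}} D C^{-1}$$ (the normalized square root factorization). Then $C^2 = M_{\mathsf{count}}$, $LR = M_{\mathsf{count}}$,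 and, with $\log$ the natural logarithm, for all $n \ge 1$, $$0.701 + \frac{\log n}{\pi} \le \gamma_2(M_{\mathsf{count}}) \le \|L\|_{2\to\infty}\|R\|_{1\to 2} \le 0.846 + \frac{\log n}{\pi} + o(1),$$ $$0.701 + \frac{\log n}{\pi} \le \gamma_F(M_{\mathsf{count}}) \le \tfrac{1}{\sqrt n}\|L\|_F\|R\|_{1\to 2} \le 0.748 + \frac{\log n}{\pi} + o(1),$$ where the $o(1)$ terms tend to $0$ as $n \to \infty$. -/

import Mathlib

open Filter Topology
open scoped ENNReal

noncomputable section

/-- The operator norm `‖A‖_{p → q} = max_x ‖A x‖_q / ‖x‖_p` of a real matrix. -/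
def opNorm (p q : ℝ≥0∞) [Fact (1 ≤ p)] [Fact (1 ≤ q)] {m k : ℕ}
    (A : Matrix (Fin m) (Fin k) ℝ) : ℝ :=
  ‖LinearMap.toContinuousLinearMap (Matrix.toLpLin p q A)‖

/-- The Frobenius norm of a real matrix. -/
def frobNorm {m k : ℕ} (A : Matrix (Fin m) (Fin k) ℝ) : ℝ :=
  √(∑ i, ∑ j, A i j ^ 2)

/-- The factorization norm `γ₂(A)`: the infimum of `‖L‖_{2 → ∞} ‖R‖_{1 → 2}` over all real
factorizations `A = L R`, of any inner dimension. -/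
def gammaTwo {n : ℕ} (A : Matrix (Fin n) (Fin n) ℝ) : ℝ :=
  sInf {c : ℝ | ∃ (k : ℕ) (L : Matrix (Fin n) (Fin k) ℝ) (R : Matrix (Fin k) (Fin n) ℝ),
    A = L * R ∧ c = opNorm 2 ∞ L * opNorm 1 2 R}

/-- The factorization norm `γ_F(A)`: the infimum of `(1 / √n) ‖L‖_F ‖R‖_{1 → 2}` over all real
factorizations `A = L R`, of any inner dimension. -/
def gammaFrob {n : ℕ} (A : Matrix (Fin n) (Fin n) ℝ) : ℝ :=
  sInf {c : ℝ | ∃ (k : ℕ) (L : Matrix (Fin n) (Fin k) ℝ) (R : Matrix (Fin k) (Fin n) ℝ),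
    A = L * R ∧ c = 1 / √(n : ℝ) * frobNorm L * opNorm 1 2 R}

/-- The lower-triangular all-ones matrix. -/
def countMatrix (n : ℕ) : Matrix (Fin n) (Fin n) ℝ :=
  Matrix.of fun i j => if j ≤ i then 1 else 0

/-- The Taylor coefficients `r_k = 4⁻ᵏ * binom(2k, k)` of `(1 - x)^(-1/2)`. -/
def sqrtCoeff (k : ℕ) : ℝ := (Nat.centralBinom k : ℝ) / 4 ^ k

/-- The lower-triangular Toeplitz matrix `C` with entries `r_{i - j}`, the square root of
`countMatrix n` with positive diagonal. -/
def sqrtMatrix (n : ℕ) : Matrix (Fin n) (Fin n) ℝ :=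
  Matrix.of fun i j => if j ≤ i then sqrtCoeff ((i : ℕ) - (j : ℕ)) else 0

/-- The Euclidean norm of the `j`-th column of `sqrtMatrix n`. -/
def sqrtColNorm (n : ℕ) (j : Fin n) : ℝ := √(∑ i, sqrtMatrix n i j ^ 2)

/-- The right factor `C D⁻¹` of the normalized square root factorization, where `D` is the
diagonal matrix of the column norms of `C`. -/
def nsrRight (n : ℕ) : Matrix (Fin n) (Fin n) ℝ :=
  sqrtMatrix n * (Matrix.diagonal (sqrtColNorm n))⁻¹

/-- The left factor `M (C D⁻¹)⁻¹` of the normalized square root factorization. -/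
def nsrLeft (n : ℕ) : Matrix (Fin n) (Fin n) ℝ :=
  countMatrix n * (nsrRight n)⁻¹

end

/-!
# The normalized square root factorization of the counting matrix

**Lower bound.** If `M = L R` and `u_j`, `v_j` are the singular vectors of `M`, then the
Cauchy-Schwarz inequality applied to `∑ u_jᵀ L R v_j` bounds the nuclear norm of `M` by
`‖L‖_F ‖R‖_F ≤ √n ‖L‖_F ‖R‖_{1 → 2}` (`sum_le_frobNorm_mul_frobNorm`). The counting matrix has the
singular values `1 / (2 sin (θ_j / 2))` with `θ_j = (2 j + 1) π / (2 n + 1)` and singular vectors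
given by sines and cosines (`countMatrix_mul_countCos`). Their mean is estimated in
`le_mean_singularValues`: the pole of `1 / sin` contributes a sum over odd numbers, and the
increasing remainder `1 / sin x - 1 / x` is compared with its integral. The limiting constant is
`(γ + log (16 / π)) / π = 0.7019...`.

**Upper bound.** The columns of the right factor are unit vectors, so only the rows of the left
factor matter. Let `r_k` be the coefficients of `(1 - x)^(-1/2)` and `s_t = ∑_{k < t} r_k ^ 2`.
Row `i` of the left factor has the entries `∑_k r̃_k √(s_{a + p - k})`, where `a = n - i`, the entry
lies `p` places left of the diagonal, and `r̃_k` are the coefficients of `(1 - x)^(1/2)`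
(`nsrLeft_apply`). Linearising the square root at `s_{a + p}` shows that the square of this entry is
`s_{a + p} r_p ^ 2` up to `O(1 / (a + p))` (`nsrEntry_sq_le`). By Wallis' formula
`r_p ^ 2 ≤ 1 / (π p)`, and `π s_t ≤ log t + κ` with `κ` slightly above `γ + log 16`
(`pi_mul_landau_le`). Summation over `p` bounds `π ^ 2` times the squared norm of the row by
`(log a + κ) (log b + κ) + λ ^ 2 / 2 + O(1 + λ)`, where `b = i + 1` and `λ = log (n / a)`
(`sum_nsrEntry_sq_le`). Its main term is largest under `a + b = n + 1` when `a = b`, which gives the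
constant `(κ - log 2) / π < 0.846` (`eventually_sum_nsrEntry_sq_le`); the mean over all rows gives
`(κ - 1) / π < 0.748`, since the mean of `log (n / a)` tends to `1`
(`eventually_mean_nsrEntry_sq_le`). Both inequalities between constants are strict, so that the
bounds hold without an error term for all large `n`.
-/

/-! ### The coefficients of `(1 - x)^(-1/2)` -/

lemma sqrtCoeff_zero : sqrtCoeff 0 = 1 := by simp [sqrtCoeff]

lemma sqrtCoeff_succ (k : ℕ) :
    sqrtCoeff (k + 1) = sqrtCoeff k * ((2 * k + 1) / (2 * k + 2)) := by
  have h : ((k : ℝ) + 1) * Nat.centralBinom (k + 1) = 2 * (2 * k + 1) * Nat.centralBinom k := by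
    exact_mod_cast Nat.succ_mul_centralBinom_succ k
  have h1 : (Nat.centralBinom (k + 1) : ℝ) = 2 * (2 * k + 1) * Nat.centralBinom k / (k + 1) := by
    rw [eq_div_iff (by positivity)]
    linarith
  simp only [sqrtCoeff, h1]
  field_simp
  ring

lemma sqrtCoeff_pos (k : ℕ) : 0 < sqrtCoeff k := by
  have := Nat.centralBinom_pos k
  unfold sqrtCoeff
  positivity

lemma sqrtCoeff_succ_le (k : ℕ) : sqrtCoeff (k + 1) ≤ sqrtCoeff k := by
  rw [sqrtCoeff_succ]
  apply mul_le_of_le_one_right (sqrtCoeff_pos k).le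
  rw [div_le_one (by positivity)]
  linarith

lemma sqrtCoeff_antitone : Antitone sqrtCoeff := antitone_nat_of_succ_le sqrtCoeff_succ_le

lemma sum_sqrtCoeff (p : ℕ) : ∑ k ∈ Finset.range p, sqrtCoeff k = 2 * p * sqrtCoeff p := by
  induction p with
  | zero => simp
  | succ p ih =>
    rw [Finset.sum_range_succ, ih, sqrtCoeff_succ]
    push_cast
    field_simp

/-- The power series with coefficients `sqrtCoeff` squares to `1 / (1 - x)`. The convolution does
not depend on `m`: weight the sum with `k`, which by symmetry multiplies it by `m / 2`, and use
`(k + 1) r_{k + 1} = (k + 1/2) r_k`. -/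
lemma sum_sqrtCoeff_mul_sqrtCoeff (m : ℕ) :
    ∑ k ∈ Finset.range (m + 1), sqrtCoeff k * sqrtCoeff (m - k) = 1 := by
  have sym : ∀ m : ℕ, ∑ k ∈ Finset.range (m + 1), (k : ℝ) * (sqrtCoeff k * sqrtCoeff (m - k)) =
      m / 2 * ∑ k ∈ Finset.range (m + 1), sqrtCoeff k * sqrtCoeff (m - k) := by
    intro m
    have h := Finset.sum_flip (n := m) fun k => (k : ℝ) * (sqrtCoeff k * sqrtCoeff (m - k))
    have h2 : ∑ k ∈ Finset.range (m + 1),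
        (((m - k : ℕ) : ℝ) * (sqrtCoeff (m - k) * sqrtCoeff (m - (m - k)))) =
        ∑ k ∈ Finset.range (m + 1), ((m : ℝ) * (sqrtCoeff k * sqrtCoeff (m - k)) -
          (k : ℝ) * (sqrtCoeff k * sqrtCoeff (m - k))) := by
      refine Finset.sum_congr rfl fun k hk => ?_
      have hk : k ≤ m := by simpa [Nat.lt_succ_iff] using hk
      rw [Nat.cast_sub hk, Nat.sub_sub_self hk]
      ring
    rw [h2, Finset.sum_sub_distrib, ← Finset.mul_sum] at h
    linarith
  induction m with
  | zero => simp [sqrtCoeff_zero]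
  | succ m ih =>
    have h := sym (m + 1)
    rw [Finset.sum_range_succ'] at h
    have h2 : ∑ k ∈ Finset.range (m + 1),
        (((k + 1 : ℕ) : ℝ) * (sqrtCoeff (k + 1) * sqrtCoeff (m + 1 - (k + 1)))) =
        ∑ k ∈ Finset.range (m + 1), ((k : ℝ) * (sqrtCoeff k * sqrtCoeff (m - k)) +
          1 / 2 * (sqrtCoeff k * sqrtCoeff (m - k))) := by
      refine Finset.sum_congr rfl fun k _ => ?_
      rw [sqrtCoeff_succ, Nat.add_sub_add_right]
      push_cast
      field_simp
    rw [h2, Finset.sum_add_distrib, sym, ← Finset.mul_sum, ih] at h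
    push_cast at h
    have h3 : ((m : ℝ) + 1) * ∑ k ∈ Finset.range (m + 1 + 1), sqrtCoeff k * sqrtCoeff (m + 1 - k)
        = (m + 1) * 1 := by linarith
    exact mul_left_cancel₀ (by positivity) h3

lemma sqrtCoeff_sq_mul_monotone : Monotone fun k : ℕ => sqrtCoeff k ^ 2 * k := by
  refine monotone_nat_of_le_succ fun k => ?_
  have h : (k : ℝ) ≤ ((2 * k + 1) / (2 * k + 2)) ^ 2 * (k + 1) := by
    rw [div_pow, div_mul_eq_mul_div, le_div_iff₀ (by positivity)]
    nlinarith [(Nat.cast_nonneg k : (0 : ℝ) ≤ k)]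
  simp only [sqrtCoeff_succ, mul_pow, mul_assoc]
  push_cast
  gcongr

lemma wallis_eq (k : ℕ) : Real.Wallis.W k = 1 / (sqrtCoeff k ^ 2 * (2 * k + 1)) := by
  induction k with
  | zero => simp [Real.Wallis.W, sqrtCoeff_zero]
  | succ k ih =>
    have := sqrtCoeff_pos k
    rw [Real.Wallis.W_succ, ih, sqrtCoeff_succ]
    push_cast
    field_simp
    ring

lemma tendsto_sqrtCoeff_sq_mul (c : ℝ) :
    Tendsto (fun k : ℕ => sqrtCoeff k ^ 2 * (k + c)) atTop (𝓝 (1 / Real.pi)) := by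
  have h1 : Tendsto (fun k : ℕ => (Real.Wallis.W k)⁻¹) atTop (𝓝 (Real.pi / 2)⁻¹) :=
    Real.Wallis.tendsto_W_nhds_pi_div_two.inv₀ (by positivity)
  have h2 : Tendsto (fun k : ℕ => 1 / 2 + (c - 1 / 2) / (2 * (k : ℝ) + 1)) atTop
      (𝓝 (1 / 2 + 0)) := by
    refine tendsto_const_nhds.add (Tendsto.div_atTop tendsto_const_nhds ?_)
    exact tendsto_atTop_add_const_right _ _
      (tendsto_natCast_atTop_atTop.const_mul_atTop (by norm_num))
  have h3 := h1.mul h2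
  have e : (Real.pi / 2)⁻¹ * (1 / 2 + 0) = 1 / Real.pi := by
    field_simp
    norm_num
  rw [e] at h3
  refine h3.congr fun k => ?_
  have := sqrtCoeff_pos k
  rw [wallis_eq]
  field_simp
  ring

lemma sqrtCoeff_sq_le (k : ℕ) : sqrtCoeff k ^ 2 ≤ 1 / (Real.pi * (k + 1 / 4)) := by
  have hm : Monotone fun k : ℕ => sqrtCoeff k ^ 2 * ((k : ℝ) + 1 / 4) := by
    refine monotone_nat_of_le_succ fun k => ?_
    have h : (k : ℝ) + 1 / 4 ≤ ((2 * k + 1) / (2 * k + 2)) ^ 2 * (k + 1 + 1 / 4) := by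
      rw [div_pow, div_mul_eq_mul_div, le_div_iff₀ (by positivity)]
      nlinarith [(Nat.cast_nonneg k : (0 : ℝ) ≤ k)]
    simp only [sqrtCoeff_succ, mul_pow, mul_assoc]
    push_cast
    gcongr
  have h := hm.ge_of_tendsto (tendsto_sqrtCoeff_sq_mul (1 / 4)) k
  have hk : (0 : ℝ) < k + 1 / 4 := by positivity
  rw [← div_div, le_div_iff₀ hk]
  exact h

lemma le_sqrtCoeff_sq (k : ℕ) : 1 / (Real.pi * (k + 1 / 3)) ≤ sqrtCoeff k ^ 2 := by
  have hm : Antitone fun k : ℕ => sqrtCoeff k ^ 2 * ((k : ℝ) + 1 / 3) := by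
    refine antitone_nat_of_succ_le fun k => ?_
    have h : ((2 * (k : ℝ) + 1) / (2 * k + 2)) ^ 2 * (k + 1 + 1 / 3) ≤ k + 1 / 3 := by
      rw [div_pow, div_mul_eq_mul_div, div_le_iff₀ (by positivity)]
      nlinarith [(Nat.cast_nonneg k : (0 : ℝ) ≤ k)]
    simp only [sqrtCoeff_succ, mul_pow, mul_assoc]
    push_cast
    gcongr
  have h := hm.le_of_tendsto (tendsto_sqrtCoeff_sq_mul (1 / 3)) k
  have hk : (0 : ℝ) < k + 1 / 3 := by positivity
  rw [← div_div, div_le_iff₀ hk]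
  exact h

lemma sqrtCoeff_sq_mul_le (k : ℕ) : sqrtCoeff k ^ 2 * k ≤ 1 / Real.pi := by
  simpa using sqrtCoeff_sq_mul_monotone.ge_of_tendsto
    (by simpa using tendsto_sqrtCoeff_sq_mul 0) k

/-! ### Partial sums of the squared coefficients (Landau's constants) -/

/-- Landau's constants: the partial sums `s_t = ∑_{k < t} r_k ^ 2`. -/
noncomputable def landau (t : ℕ) : ℝ := ∑ k ∈ Finset.range t, sqrtCoeff k ^ 2

lemma landau_succ (t : ℕ) : landau (t + 1) = landau t + sqrtCoeff t ^ 2 :=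
  Finset.sum_range_succ _ _

lemma landau_mono : Monotone landau :=
  monotone_nat_of_le_succ fun t => by
    rw [landau_succ]
    have := sq_nonneg (sqrtCoeff t)
    linarith

lemma one_le_landau {t : ℕ} (ht : 1 ≤ t) : 1 ≤ landau t :=
  le_trans (by simp [landau, sqrtCoeff_zero]) (landau_mono ht)

lemma landau_nonneg (t : ℕ) : 0 ≤ landau t := Finset.sum_nonneg fun _ _ => sq_nonneg _

/-- An upper bound for `log y` coming from `log √y ≤ sinh (log √y)`. -/
lemma log_le_div_sqrt {y : ℝ} (hy : 1 ≤ y) : Real.log y ≤ (y - 1) / √y := by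
  have h0 : 0 < √y := Real.sqrt_pos.2 (by linarith)
  have h1 : 0 ≤ Real.log √y := Real.log_nonneg (Real.one_le_sqrt.2 hy)
  have h2 := Real.self_le_sinh_iff.2 h1
  rw [Real.sinh_log h0, Real.log_sqrt (by linarith)] at h2
  have h3 : (y - 1) / √y = √y - (√y)⁻¹ := by
    field_simp
    rw [Real.sq_sqrt (by linarith)]
  rw [h3]
  linarith

/-- A lower bound for `log (a / b)` by the midpoint rule. -/
lemma le_log_div {a b : ℝ} (hb : 0 < b) (hab : b ≤ a) :
    2 * (a - b) / (a + b) ≤ Real.log (a / b) := by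
  have h := Real.le_log_one_add_of_nonneg (x := (a - b) / b) (div_nonneg (by linarith) hb.le)
  have e1 : 1 + (a - b) / b = a / b := by
    field_simp
    ring
  have e2 : 2 * ((a - b) / b) / ((a - b) / b + 2) = 2 * (a - b) / (a + b) := by
    rw [show (a - b) / b + 2 = (a + b) / b by field_simp; ring]
    field_simp
  rwa [e1, e2] at h

lemma log_succ_div_le_sqrtCoeff_sq {k : ℕ} (hk : 1 ≤ k) :
    Real.log ((k + 1 : ℝ) / k) ≤ Real.pi * sqrtCoeff k ^ 2 := by
  have hk' : (1 : ℝ) ≤ k := by exact_mod_cast hk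
  have h1 : (1 : ℝ) ≤ (k + 1) / k := by
    rw [le_div_iff₀ (by linarith)]
    linarith
  have h2 : (k : ℝ) * (1 + 1 / (3 * k)) = k + 1 / 3 := by field_simp
  have h3 : 1 + 1 / (3 * (k : ℝ)) ≤ √((k + 1) / k) := by
    apply Real.le_sqrt_of_sq_le
    rw [show ((k : ℝ) + 1) / k = 1 + 1 / k by field_simp]
    have : (1 : ℝ) / k = 3 * (1 / (3 * k)) := by field_simp
    have h5 : 1 / (3 * (k : ℝ)) ≤ 1 := by
      rw [div_le_one (by linarith)]
      linarith
    have h6 : 0 ≤ 1 / (3 * (k : ℝ)) := by positivity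
    rw [this]
    nlinarith
  calc Real.log ((k + 1 : ℝ) / k) ≤ ((k + 1 : ℝ) / k - 1) / √((k + 1) / k) := log_le_div_sqrt h1
    _ ≤ ((k + 1 : ℝ) / k - 1) / (1 + 1 / (3 * (k : ℝ))) := by
        gcongr
    _ = 1 / (k + 1 / 3) := by
        rw [← h2]
        field_simp
        ring
    _ = Real.pi * (1 / (Real.pi * (k + 1 / 3))) := by
        have := Real.pi_pos
        field_simp
    _ ≤ Real.pi * sqrtCoeff k ^ 2 := by
        gcongr
        exact le_sqrtCoeff_sq k

lemma sqrtCoeff_sq_le_log_div {k : ℕ} (hk : 1 ≤ k) :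
    Real.pi * sqrtCoeff k ^ 2 ≤ Real.log ((k + 3 / 4 : ℝ) / (k - 1 / 4)) := by
  have hk' : (1 : ℝ) ≤ k := by exact_mod_cast hk
  have h := le_log_div (a := (k + 3 / 4 : ℝ)) (b := k - 1 / 4) (by linarith) (by linarith)
  refine le_trans ?_ h
  calc Real.pi * sqrtCoeff k ^ 2 ≤ Real.pi * (1 / (Real.pi * (k + 1 / 4))) := by
        gcongr
        exact sqrtCoeff_sq_le k
    _ = _ := by
        have := Real.pi_pos
        rw [show (k : ℝ) + 3 / 4 + (k - 1 / 4) = 2 * (k + 1 / 4) by ring]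
        field_simp
        ring

/-- `π s_t - log t` increases with `t`. -/
lemma landau_sub_log_mono {t u : ℕ} (ht : 1 ≤ t) (htu : t ≤ u) :
    Real.pi * landau t - Real.log t ≤ Real.pi * landau u - Real.log u := by
  induction u, htu using Nat.le_induction with
  | base => rfl
  | succ u hu ih =>
    have hu1 : (1 : ℝ) ≤ u := by exact_mod_cast ht.trans hu
    have h := log_succ_div_le_sqrtCoeff_sq (ht.trans hu)
    rw [Real.log_div (by linarith) (by linarith)] at h
    rw [landau_succ]
    push_cast
    linarith

/-- `π s_t - log (t - 1/4)` decreases with `t`. -/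
lemma landau_sub_log_anti {t u : ℕ} (ht : 1 ≤ t) (htu : t ≤ u) :
    Real.pi * landau u - Real.log (u - 1 / 4) ≤ Real.pi * landau t - Real.log (t - 1 / 4) := by
  induction u, htu using Nat.le_induction with
  | base => rfl
  | succ u hu ih =>
    have hu1 : (1 : ℝ) ≤ u := by exact_mod_cast ht.trans hu
    have h := sqrtCoeff_sq_le_log_div (ht.trans hu)
    rw [Real.log_div (by linarith) (by linarith)] at h
    rw [landau_succ]
    push_cast
    rw [show (u : ℝ) + 1 - 1 / 4 = u + 3 / 4 by ring]
    linarith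

lemma landau_thirty_two_le : landau 32 ≤ 2.166976 := by
  have h : (∑ k ∈ Finset.range 32, (Nat.centralBinom k * 4 ^ (31 - k)) ^ 2) * 1000000 ≤
      2166976 * (4 ^ 31) ^ 2 := by
    decide +kernel
  have h' : (∑ k ∈ Finset.range 32, ((Nat.centralBinom k : ℝ) * 4 ^ (31 - k)) ^ 2) * 1000000 ≤
      2166976 * (4 ^ 31) ^ 2 := by
    exact_mod_cast h
  have e : landau 32 * (4 ^ 31) ^ 2 =
      ∑ k ∈ Finset.range 32, ((Nat.centralBinom k : ℝ) * 4 ^ (31 - k)) ^ 2 := by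
    rw [landau, Finset.sum_mul]
    refine Finset.sum_congr rfl fun k hk => ?_
    have hk : k ≤ 31 := Nat.lt_succ_iff.1 (Finset.mem_range.1 hk)
    rw [← mul_pow, sqrtCoeff, div_mul_eq_mul_div, mul_div_assoc, pow_sub₀ _ (by norm_num) hk]
    rfl
  rw [← e] at h'
  norm_num at h' ⊢
  linarith

/-- The upper bound `s_t ≤ (log t + κ) / π` with `κ = 3.3499`. The optimal constant is
`γ + log 16 = 3.34980...`; evaluation at `t = 32` suffices since `π s_t - log t` increases while
`π s_t - log (t - 1/4)`, which has the same limit, decreases. -/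
lemma pi_mul_landau_le {t : ℕ} (ht : 1 ≤ t) : Real.pi * landau t ≤ Real.log t + 3.3499 := by
  set u := max t 32 with hu
  have h1 := landau_sub_log_mono ht (le_max_left t 32)
  have h2 := landau_sub_log_anti (by norm_num) (le_max_right t 32)
  have hu32 : (32 : ℝ) ≤ u := by exact_mod_cast le_max_right t 32
  have h3 : Real.log ((u : ℝ) - 1 / 4) ≤ Real.log u :=
    Real.log_le_log (by linarith) (by linarith)
  have h4 : Real.pi * landau 32 ≤ 3.141593 * 2.166976 :=
    mul_le_mul Real.pi_lt_d6.le landau_thirty_two_le (landau_nonneg _) (by norm_num)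
  have h5 : 5 * Real.log 2 + (1 - 128 / 127) ≤ Real.log ((32 : ℕ) - 1 / 4) := by
    have e : ((32 : ℕ) : ℝ) - 1 / 4 = 2 ^ 5 * (127 / 128) := by norm_num
    have h := Real.one_sub_inv_le_log_of_pos (x := 127 / 128) (by norm_num)
    rw [e, Real.log_mul (by norm_num) (by norm_num), Real.log_pow]
    norm_num at h ⊢
    linarith
  have h6 := Real.log_two_gt_d9
  rw [← hu] at h1 h2
  norm_num at h4 h5 h6 ⊢
  linarith

/-! ### Entries and rows of the left factor -/

/-- The Taylor coefficients of `(1 - x)^(1/2)`: the first differences of `sqrtCoeff`. -/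
noncomputable def sqrtInvCoeff : ℕ → ℝ
  | 0 => 1
  | k + 1 => sqrtCoeff (k + 1) - sqrtCoeff k

lemma sum_sqrtInvCoeff (p : ℕ) : ∑ k ∈ Finset.range (p + 1), sqrtInvCoeff k = sqrtCoeff p := by
  induction p with
  | zero => simp [sqrtInvCoeff, sqrtCoeff_zero]
  | succ p ih =>
    rw [Finset.sum_range_succ, ih, sqrtInvCoeff]
    ring

lemma sqrtInvCoeff_succ_nonpos (k : ℕ) : sqrtInvCoeff (k + 1) ≤ 0 :=
  sub_nonpos.2 (sqrtCoeff_succ_le k)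

/-- Summation by parts against `sqrtInvCoeff`. -/
lemma sum_sqrtInvCoeff_mul (G : ℕ → ℝ) (p : ℕ) :
    ∑ k ∈ Finset.range (p + 1), sqrtInvCoeff k * G k =
      G 0 * sqrtCoeff p +
        ∑ k ∈ Finset.range p, (G k - G (k + 1)) * (sqrtCoeff k - sqrtCoeff p) := by
  have h1 : ∑ k ∈ Finset.range (p + 1), sqrtInvCoeff k * G k =
      G p * sqrtCoeff p + ∑ k ∈ Finset.range p, (G k - G (k + 1)) * sqrtCoeff k := by
    induction p with
    | zero => simp [sqrtInvCoeff, sqrtCoeff_zero]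
    | succ p ih =>
      rw [Finset.sum_range_succ, ih, Finset.sum_range_succ _ p, sqrtInvCoeff]
      ring
  have h2 := Finset.sum_range_sub' G p
  rw [Finset.sum_sub_distrib] at h2
  simp only [mul_sub, Finset.sum_sub_distrib, ← Finset.sum_mul]
  rw [h1, h2]
  ring

/-- The entry of the left factor that lies `p` places left of the diagonal, in the row number
`a` counted from the bottom of the matrix, starting with `1`. Here `√(landau t)` is the norm of the
column of `sqrtMatrix n` with number `t`, counted from the right. -/
noncomputable def nsrEntry (a p : ℕ) : ℝ :=
  ∑ k ∈ Finset.range (p + 1), sqrtInvCoeff k * √(landau (a + p - k))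

lemma nsrEntry_nonneg (a p : ℕ) : 0 ≤ nsrEntry a p := by
  have h : ∑ k ∈ Finset.range (p + 1), sqrtInvCoeff k * √(landau (a + p)) ≤ nsrEntry a p := by
    refine Finset.sum_le_sum fun k _ => ?_
    rcases k with _ | k
    · simp
    · exact mul_le_mul_of_nonpos_left (Real.sqrt_le_sqrt (landau_mono (Nat.sub_le _ _)))
        (sqrtInvCoeff_succ_nonpos k)
  rw [← Finset.sum_mul, sum_sqrtInvCoeff] at h
  exact le_trans (mul_nonneg (sqrtCoeff_pos p).le (Real.sqrt_nonneg _)) h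

/-- The square root of Landau's constants is linearised at the end point `a + p`: as all
coefficients but the first are nonpositive, `√s ≥ s / √S` for `s ≤ S` gives an upper bound. -/
lemma sqrt_landau_mul_nsrEntry_le (a p : ℕ) :
    √(landau (a + p)) * nsrEntry a p ≤
      ∑ k ∈ Finset.range (p + 1), sqrtInvCoeff k * landau (a + p - k) := by
  rw [nsrEntry, Finset.mul_sum]
  refine Finset.sum_le_sum fun k _ => ?_
  rcases k with _ | k
  · simp [sqrtInvCoeff, Real.mul_self_sqrt (landau_nonneg _)]
  · have h : landau (a + p - (k + 1)) ≤ √(landau (a + p)) * √(landau (a + p - (k + 1))) := by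
      nth_rewrite 1 [← Real.mul_self_sqrt (landau_nonneg (a + p - (k + 1)))]
      gcongr
      exact landau_mono (Nat.sub_le _ _)
    nlinarith [mul_le_mul_of_nonpos_left h (sqrtInvCoeff_succ_nonpos k)]

lemma sqrtCoeff_sub_le {k p : ℕ} (hkp : k < p) :
    sqrtCoeff k - sqrtCoeff p ≤ sqrtCoeff k * ((p - k) / p) := by
  have hp : (0 : ℝ) < p := by exact_mod_cast (Nat.zero_le k).trans_lt hkp
  have h1 : sqrtCoeff k ^ 2 * k ≤ sqrtCoeff p ^ 2 * p := sqrtCoeff_sq_mul_monotone hkp.le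
  have h2 := sqrtCoeff_pos k
  have h3 := sqrtCoeff_pos p
  have h4 := sqrtCoeff_antitone hkp.le
  rw [mul_div_assoc', le_div_iff₀ hp]
  have h5 : sqrtCoeff k * ((sqrtCoeff k - sqrtCoeff p) * p) ≤
      sqrtCoeff k * (sqrtCoeff k * (p - k)) := by
    nlinarith [mul_nonneg (mul_nonneg h3.le (sub_nonneg.2 h4)) hp.le]
  exact le_of_mul_le_mul_left h5 h2

lemma sum_sqrtInvCoeff_mul_landau_le {a p : ℕ} (ha : 1 ≤ a) (hp : 1 ≤ p) :
    ∑ k ∈ Finset.range (p + 1), sqrtInvCoeff k * landau (a + p - k) ≤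
      landau (a + p) * sqrtCoeff p + 2 * (p * sqrtCoeff p / (a + p - 1)) := by
  have ha' : (1 : ℝ) ≤ a := by exact_mod_cast ha
  have hp' : (1 : ℝ) ≤ p := by exact_mod_cast hp
  rw [sum_sqrtInvCoeff_mul fun k => landau (a + p - k)]
  simp only [Nat.sub_zero]
  gcongr
  have h : ∀ k ∈ Finset.range p, (landau (a + p - k) - landau (a + p - (k + 1))) *
      (sqrtCoeff k - sqrtCoeff p) ≤ 1 / (a + p - 1) * sqrtCoeff k := by
    intro k hk
    have hk : k < p := Finset.mem_range.1 hk
    have hk' : (k : ℝ) + 1 ≤ p := by exact_mod_cast hk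
    have e : a + p - k = (a + p - (k + 1)) + 1 := by omega
    rw [e, landau_succ, add_sub_cancel_left]
    set m := a + p - (k + 1) with hm
    have hmr : (m : ℝ) = a + p - 1 - k := by
      have : m + (k + 1) = a + p := by omega
      have : (m : ℝ) + (k + 1) = a + p := by exact_mod_cast this
      linarith
    have hm1 : (0 : ℝ) < m := by linarith
    have h1 : sqrtCoeff m ^ 2 ≤ 1 / m := by
      rw [le_div_iff₀ hm1]
      refine (sqrtCoeff_sq_mul_le m).trans ?_
      rw [div_le_one Real.pi_pos]
      linarith [Real.pi_gt_three]
    have h2 : (1 : ℝ) / m * ((p - k) / p) ≤ 1 / (a + p - 1) := by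
      rw [div_mul_div_comm, div_le_div_iff₀ (by positivity) (by linarith), hmr]
      nlinarith [mul_nonneg (Nat.cast_nonneg k : (0 : ℝ) ≤ k) (sub_nonneg.2 ha')]
    calc sqrtCoeff m ^ 2 * (sqrtCoeff k - sqrtCoeff p)
        ≤ 1 / m * (sqrtCoeff k * ((p - k) / p)) := by
          gcongr
          · linarith [sqrtCoeff_antitone hk.le]
          · exact sqrtCoeff_sub_le hk
      _ = 1 / m * ((p - k) / p) * sqrtCoeff k := by ring
      _ ≤ 1 / (a + p - 1) * sqrtCoeff k := by
          gcongr
          exact (sqrtCoeff_pos k).le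
  refine (Finset.sum_le_sum h).trans ?_
  rw [← Finset.mul_sum, sum_sqrtCoeff]
  exact le_of_eq (by ring)

lemma nsrEntry_sq_le {a p : ℕ} (ha : 1 ≤ a) (hp : 1 ≤ p) :
    nsrEntry a p ^ 2 ≤ landau (a + p) * sqrtCoeff p ^ 2 + 8 / (a + p - 1) := by
  have ha' : (1 : ℝ) ≤ a := by exact_mod_cast ha
  have hp' : (1 : ℝ) ≤ p := by exact_mod_cast hp
  have hD : (0 : ℝ) < a + p - 1 := by linarith
  have hS : 1 ≤ landau (a + p) := one_le_landau (by omega)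
  set S := landau (a + p)
  set r := sqrtCoeff p
  have hr : 0 < r := sqrtCoeff_pos p
  set X := p * r / (a + p - 1 : ℝ) with hX
  have hX0 : 0 ≤ X := by positivity
  have h1 : √S * nsrEntry a p ≤ S * r + 2 * X :=
    (sqrt_landau_mul_nsrEntry_le a p).trans (sum_sqrtInvCoeff_mul_landau_le ha hp)
  have h2 : S * nsrEntry a p ^ 2 ≤ (S * r + 2 * X) ^ 2 := by
    have := pow_le_pow_left₀ (mul_nonneg (Real.sqrt_nonneg _) (nsrEntry_nonneg a p)) h1 2
    rwa [mul_pow, Real.sq_sqrt (by linarith)] at this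
  have hr2 : r ^ 2 * p ≤ 1 := by
    refine (sqrtCoeff_sq_mul_le p).trans ?_
    rw [div_le_one Real.pi_pos]
    linarith [Real.pi_gt_three]
  have h3 : r * X ≤ 1 / (a + p - 1) := by
    rw [hX, mul_div_assoc']
    gcongr
    linarith
  have h4 : X ^ 2 ≤ 1 / (a + p - 1) := by
    have e : X ^ 2 = r * X * (p / (a + p - 1)) := by
      rw [hX]
      ring
    have h5 : (p : ℝ) / (a + p - 1) ≤ 1 := by
      rw [div_le_one hD]
      linarith
    rw [e]
    exact (mul_le_of_le_one_right (by positivity) h5).trans h3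
  have e8 : 8 / (a + p - 1 : ℝ) = 8 * (1 / (a + p - 1)) := by ring
  rw [e8]
  have h6 : S * nsrEntry a p ^ 2 ≤ S * (S * r ^ 2 + 8 * (1 / (a + p - 1))) := by
    nlinarith [mul_nonneg (sub_nonneg.2 hS) (sub_nonneg.2 h4),
      mul_le_mul_of_nonneg_left h3 (by linarith : (0 : ℝ) ≤ S),
      mul_le_mul_of_nonneg_left h4 (by linarith : (0 : ℝ) ≤ S), sq_nonneg X]
  exact le_of_mul_le_mul_left h6 (by linarith)

lemma sum_one_div_le_log {a : ℕ} (ha : 1 ≤ a) (b : ℕ) :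
    ∑ p ∈ Finset.range b, (1 : ℝ) / (a + p) ≤ 1 + Real.log ((a + b) / a) := by
  have ha' : (1 : ℝ) ≤ a := by exact_mod_cast ha
  have key : ∀ b : ℕ, ∑ p ∈ Finset.range b, (1 : ℝ) / (a + p) + 1 / (a + b) ≤
      1 + Real.log ((a + b) / a) := by
    intro b
    induction b with
    | zero =>
      have : (1 : ℝ) / a ≤ 1 := by
        rw [div_le_one] <;> linarith
      simpa [div_self (by linarith : (a : ℝ) ≠ 0)] using this
    | succ b ih =>
      have hb : (0 : ℝ) ≤ b := Nat.cast_nonneg b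
      have h := Real.one_sub_inv_le_log_of_pos (x := (a + b + 1 : ℝ) / (a + b)) (by positivity)
      have e : 1 - ((a + b + 1 : ℝ) / (a + b))⁻¹ = 1 / (a + b + 1) := by
        field_simp
        ring
      rw [e, Real.log_div (by positivity) (by positivity)] at h
      rw [Finset.sum_range_succ]
      rw [Real.log_div (by positivity) (by positivity)] at ih ⊢
      push_cast
      rw [← add_assoc (a : ℝ)]
      linarith
  exact le_trans (le_add_of_nonneg_right (by positivity)) (key b)

/-- One step of a Riemann sum for `∫ log (1 + u) / u`, with `∫ log (1 + u) / (1 + u) =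
log (1 + u) ^ 2 / 2` as the main part. -/
lemma log_one_add_div_le {a : ℕ} (ha : 1 ≤ a) (p : ℕ) :
    1 / (p + 1 : ℝ) * Real.log ((a + (p + 1 : ℕ)) / a) ≤
      (Real.log ((a + (p + 1 : ℕ)) / a) ^ 2 / 2 - Real.log ((a + p) / a) ^ 2 / 2) +
        3 / 2 * (1 / (a + p)) := by
  have ha' : (1 : ℝ) ≤ a := by exact_mod_cast ha
  have hp : (0 : ℝ) ≤ p := Nat.cast_nonneg p
  push_cast
  set w := Real.log ((a + (p + 1 : ℝ)) / a) with hw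
  set v := Real.log ((a + p : ℝ) / a) with hv
  have hw0 : 0 ≤ w := Real.log_nonneg (by rw [le_div_iff₀] <;> linarith)
  have hwp : w ≤ (p + 1) / a := by
    have := Real.log_le_sub_one_of_pos (x := (a + (p + 1 : ℝ)) / a) (by positivity)
    have e : (a + (p + 1 : ℝ)) / a - 1 = (p + 1) / a := by
      field_simp
      ring
    rwa [e] at this
  have e1 : w - v = Real.log ((a + (p + 1) : ℝ) / (a + p)) := by
    rw [hw, hv, Real.log_div (by positivity) (by positivity),
      Real.log_div (by positivity) (by positivity), Real.log_div (by positivity) (by positivity)]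
    ring
  have h1 : 1 / (a + (p + 1) : ℝ) ≤ w - v := by
    rw [e1]
    have h := Real.one_sub_inv_le_log_of_pos (x := (a + (p + 1) : ℝ) / (a + p)) (by positivity)
    refine le_trans (le_of_eq ?_) h
    field_simp
    ring
  have h2 : w - v ≤ 1 / (a + p) := by
    rw [e1]
    have h := Real.log_le_sub_one_of_pos (x := (a + (p + 1) : ℝ) / (a + p)) (by positivity)
    refine h.trans (le_of_eq ?_)
    field_simp
    ring
  have h3 : 1 / (a + p : ℝ) ≤ 1 := by
    rw [div_le_one] <;> linarith
  have h4 : 1 / (p + 1 : ℝ) * w = 1 / (a + (p + 1)) * w + a / ((p + 1) * (a + (p + 1))) * w := by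
    field_simp
    ring
  have h5 : a / ((p + 1) * (a + (p + 1)) : ℝ) * w ≤ 1 / (a + p) := by
    calc a / ((p + 1) * (a + (p + 1)) : ℝ) * w
        ≤ a / ((p + 1) * (a + (p + 1)) : ℝ) * ((p + 1) / a) := by gcongr
      _ = 1 / (a + (p + 1)) := by field_simp
      _ ≤ 1 / (a + p) := by
        gcongr
        linarith
  have h6 := mul_le_mul_of_nonneg_right h1 hw0
  have h7 : (w - v) ^ 2 ≤ 1 / (a + p) := by
    have h0 : 0 ≤ w - v := le_trans (by positivity) h1
    nlinarith
  rw [h4]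
  nlinarith

/-- The squared norm of a row of the left factor, up to the factor `π ^ 2`. Here
`n = a + b - 1`; the last two terms are negligible unless `a` is much smaller than `n`. -/
lemma sum_nsrEntry_sq_le {a b : ℕ} (ha : 1 ≤ a) (hb : 1 ≤ b) :
    Real.pi ^ 2 * ∑ p ∈ Finset.range b, nsrEntry a p ^ 2 ≤
      (Real.log a + 3.3499) * (Real.log b + 3.3499) +
        Real.log ((a + b - 1 : ℕ) / a) ^ 2 / 2 + 81 * (1 + Real.log ((a + b - 1 : ℕ) / a)) := by
  obtain ⟨b, rfl⟩ : ∃ c, b = c + 1 := ⟨b - 1, by omega⟩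
  have ha' : (1 : ℝ) ≤ a := by exact_mod_cast ha
  have hla : 0 ≤ Real.log a := Real.log_nonneg ha'
  have hpi := Real.pi_pos
  have e0 : a + (b + 1) - 1 = a + b := by omega
  rw [e0]
  have hterm : ∀ p ∈ Finset.range b, Real.pi ^ 2 * nsrEntry a (p + 1) ^ 2 ≤
      Real.pi * (Real.log a + 3.3499) * sqrtCoeff (p + 1) ^ 2 +
      ((Real.log ((a + (p + 1 : ℕ)) / a) ^ 2 / 2 - Real.log ((a + p) / a) ^ 2 / 2) +
        81 * (1 / (a + p))) := by
    intro p _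
    have hp : (0 : ℝ) ≤ p := Nat.cast_nonneg p
    have h1 := nsrEntry_sq_le ha (Nat.le_add_left 1 p)
    have h2 := pi_mul_landau_le (t := a + (p + 1)) (by omega)
    have h3 := sqrtCoeff_sq_mul_le (p + 1)
    have h4 := log_one_add_div_le ha p
    have e1 : Real.log ((a + (p + 1) : ℕ) : ℝ) =
        Real.log a + Real.log ((a + (p + 1 : ℕ)) / a) := by
      rw [Real.log_div (by positivity) (by positivity)]
      push_cast
      ring
    have hw : 0 ≤ Real.log ((a + (p + 1 : ℕ) : ℝ) / a) :=
      Real.log_nonneg (by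
        rw [le_div_iff₀ (by linarith)]
        push_cast
        linarith)
    rw [e1] at h2
    set w := Real.log ((a + (p + 1 : ℕ) : ℝ) / a)
    set r := sqrtCoeff (p + 1)
    have h5 : Real.pi * r ^ 2 ≤ 1 / (p + 1 : ℝ) := by
      push_cast at h3
      rw [le_div_iff₀ hpi] at h3
      rw [le_div_iff₀ (by positivity)]
      linarith
    have e2 : (a + (p + 1 : ℕ) - 1 : ℝ) = a + p := by
      push_cast
      ring
    rw [e2] at h1
    have h6 : Real.pi ^ 2 ≤ 9.9 := by nlinarith [Real.pi_lt_d6]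
    have h7 : (0 : ℝ) ≤ 1 / (a + p) := by positivity
    calc Real.pi ^ 2 * nsrEntry a (p + 1) ^ 2
        ≤ Real.pi ^ 2 * (landau (a + (p + 1)) * r ^ 2 + 8 / (a + p)) := by gcongr
      _ = (Real.pi * landau (a + (p + 1))) * (Real.pi * r ^ 2) +
          Real.pi ^ 2 * (8 * (1 / (a + p))) := by ring
      _ ≤ (Real.log a + w + 3.3499) * (Real.pi * r ^ 2) + 9.9 * (8 * (1 / (a + p))) := by gcongr
      _ = Real.pi * (Real.log a + 3.3499) * r ^ 2 + (Real.pi * r ^ 2) * w +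
          79.2 * (1 / (a + p)) := by ring
      _ ≤ Real.pi * (Real.log a + 3.3499) * r ^ 2 + 1 / (p + 1) * w +
          79.2 * (1 / (a + p)) := by gcongr
      _ ≤ _ := by linarith
  have hsum := Finset.sum_le_sum hterm
  rw [Finset.sum_add_distrib, Finset.sum_add_distrib,
    Finset.sum_range_sub (fun p : ℕ => Real.log ((a + p : ℝ) / a) ^ 2 / 2),
    ← Finset.mul_sum, ← Finset.mul_sum, ← Finset.mul_sum] at hsum
  have hone := sum_one_div_le_log ha b
  have h0 : Real.pi ^ 2 * nsrEntry a 0 ^ 2 ≤ Real.pi * (Real.log a + 3.3499) := by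
    have e : nsrEntry a 0 ^ 2 = landau a := by
      simp [nsrEntry, sqrtInvCoeff, Real.sq_sqrt (landau_nonneg a)]
    rw [e, pow_two, mul_assoc]
    exact mul_le_mul_of_nonneg_left (pi_mul_landau_le ha) hpi.le
  have hs : landau (b + 1) = 1 + ∑ p ∈ Finset.range b, sqrtCoeff (p + 1) ^ 2 := by
    rw [landau, Finset.sum_range_succ', sqrtCoeff_zero]
    ring
  have hb1 := mul_le_mul_of_nonneg_left (pi_mul_landau_le (t := b + 1) (by omega))
    (by linarith : 0 ≤ Real.log a + 3.3499)
  have ez : Real.log ((a + ((0 : ℕ) : ℝ)) / a) = 0 := by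
    rw [Nat.cast_zero, add_zero, div_self (by linarith), Real.log_one]
  rw [ez] at hsum
  rw [Finset.sum_range_succ', mul_add]
  rw [hs] at hb1
  push_cast at hsum hb1 ⊢
  nlinarith

/-! ### Asymptotics of the row norms and of their quadratic mean -/

lemma tendsto_log_natCast : Tendsto (fun n : ℕ => Real.log n) atTop atTop :=
  Real.tendsto_log_atTop.comp tendsto_natCast_atTop_atTop

/-- Rows with `a ≥ n e⁻⁴` are handled by the inequality of arithmetic and geometric means, since
`a b ≤ ((n + 1) / 2) ^ 2`. For the others the factor `log a` is so small that the remaining terms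
do not matter. -/
lemma eventually_sum_nsrEntry_sq_le :
    ∀ᶠ n : ℕ in atTop, ∀ a b : ℕ, 1 ≤ a → 1 ≤ b → a + b = n + 1 →
      ∑ p ∈ Finset.range b, nsrEntry a p ^ 2 ≤ (0.846 + Real.log n / Real.pi) ^ 2 := by
  filter_upwards [tendsto_log_natCast.eventually_ge_atTop 10000000, eventually_ge_atTop 100000]
    with n hl hn a b ha hb hab
  have hn' : (100000 : ℝ) ≤ n := by exact_mod_cast hn
  have ha' : (1 : ℝ) ≤ a := by exact_mod_cast ha
  have hb' : (1 : ℝ) ≤ b := by exact_mod_cast hb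
  have habr : (a : ℝ) + b = n + 1 := by exact_mod_cast hab
  have hpi := Real.pi_pos
  have hpi6 := Real.pi_gt_d6
  have h := sum_nsrEntry_sq_le ha hb
  rw [show a + b - 1 = n by omega, Real.log_div (by linarith) (by linarith)] at h
  refine le_of_mul_le_mul_left (h.trans ?_) (by positivity : 0 < Real.pi ^ 2)
  have e : Real.pi ^ 2 * (0.846 + Real.log n / Real.pi) ^ 2 =
      (Real.log n + 0.846 * Real.pi) ^ 2 := by
    field_simp
    ring
  rw [e]
  have hc : (Real.log n + 2.65778) ^ 2 ≤ (Real.log n + 0.846 * Real.pi) ^ 2 := by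
    gcongr
    linarith
  refine le_trans ?_ hc
  have hla : 0 ≤ Real.log a := Real.log_nonneg ha'
  have hlb : 0 ≤ Real.log b := Real.log_nonneg hb'
  have hlbn : Real.log b ≤ Real.log n := Real.log_le_log (by linarith) (by linarith)
  have hlan : Real.log a ≤ Real.log n := Real.log_le_log (by linarith) (by linarith)
  set ℓ := Real.log n
  set x := Real.log a
  set y := Real.log b
  rcases le_total (ℓ - x) 4 with hcase | hcase
  · have hxy : x + y ≤ 2 * (ℓ - 0.69313) := by
      have h1 : (a : ℝ) * b ≤ (n + 1) ^ 2 / 4 := by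
        rw [← habr]
        nlinarith [sq_nonneg ((a : ℝ) - b)]
      have h2 : x + y ≤ Real.log ((n + 1) ^ 2 / 4) := by
        rw [← Real.log_mul (by linarith) (by linarith)]
        exact Real.log_le_log (by positivity) h1
      have h3 : Real.log ((n + 1) ^ 2 / 4) = 2 * (ℓ + Real.log ((n + 1) / n) - Real.log 2) := by
        rw [Real.log_div (by positivity) (by norm_num), Real.log_pow,
          Real.log_div (by positivity) (by positivity),
          show (4 : ℝ) = 2 ^ 2 by norm_num, Real.log_pow]
        push_cast
        ring
      have h4 : Real.log ((n + 1 : ℝ) / n) ≤ 1 / n := by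
        refine (Real.log_le_sub_one_of_pos (by positivity)).trans (le_of_eq ?_)
        field_simp
        ring
      have h5 : (1 : ℝ) / n ≤ 1 / 100000 := by gcongr
      have h6 := Real.log_two_gt_d9
      linarith
    have h1 : (x + 3.3499) * (y + 3.3499) ≤ (ℓ + 2.65677) ^ 2 := by
      have h2 : (x + 3.3499) * (y + 3.3499) ≤ ((x + y) / 2 + 3.3499) ^ 2 := by
        nlinarith [sq_nonneg (x - y)]
      refine h2.trans (pow_le_pow_left₀ (by linarith) (by linarith) 2)
    nlinarith
  · have h1 : (x + 3.3499) * (y + 3.3499) ≤ (x + 3.3499) * (ℓ + 3.3499) := by gcongr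
    have h2 : (ℓ - x) ^ 2 ≤ (ℓ - x) * ℓ := by nlinarith
    nlinarith

lemma log_sq_le_sqrt {y : ℝ} (hy : 1 ≤ y) : Real.log y ^ 2 ≤ 16 * √y := by
  have h0 : 0 < √√y := Real.sqrt_pos.2 (Real.sqrt_pos.2 (by linarith))
  have h1 : Real.log y = 4 * Real.log √√y := by
    rw [Real.log_sqrt (Real.sqrt_nonneg _), Real.log_sqrt (by linarith)]
    ring
  have h2 : Real.log √√y ≤ √√y := (Real.log_le_sub_one_of_pos h0).trans (by linarith)
  have h3 : 0 ≤ Real.log √√y :=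
    Real.log_nonneg (Real.one_le_sqrt.2 (Real.one_le_sqrt.2 hy))
  have h4 : √√y ^ 2 = √y := Real.sq_sqrt (Real.sqrt_nonneg _)
  rw [h1]
  nlinarith

lemma sum_log_le (n : ℕ) :
    ∑ i ∈ Finset.range (n + 1), Real.log ((i + 1 : ℕ)) ≤
      (n + 1) * Real.log (n + 1) - (n + 1) + Real.log (n + 1) + 1 := by
  induction n with
  | zero => simp
  | succ n ih =>
    rw [Finset.sum_range_succ]
    have hn : (0 : ℝ) ≤ n := Nat.cast_nonneg n
    have h := Real.one_sub_inv_le_log_of_pos (x := (n + 2 : ℝ) / (n + 1)) (by positivity)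
    rw [Real.log_div (by positivity) (by positivity), inv_div] at h
    have h2 : 1 - (n + 1 : ℝ) / (n + 2) = 1 / (n + 2) := by
      field_simp
      ring
    rw [h2, div_le_iff₀ (by positivity)] at h
    push_cast at ih ⊢
    rw [show (n : ℝ) + 1 + 1 = n + 2 by ring]
    linarith

lemma sum_one_div_sqrt_le (n : ℕ) :
    ∑ i ∈ Finset.range n, 1 / √((i + 1 : ℕ) : ℝ) ≤ 2 * √n := by
  induction n with
  | zero => simp
  | succ n ih =>
    rw [Finset.sum_range_succ]
    have h0 : 0 < √((n + 1 : ℕ) : ℝ) := Real.sqrt_pos.2 (by positivity)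
    have h1 : √((n + 1 : ℕ) : ℝ) ^ 2 = n + 1 := by
      rw [Real.sq_sqrt (by positivity)]
      push_cast
      ring
    have h2 : √(n : ℝ) ^ 2 = n := Real.sq_sqrt (by positivity)
    have h3 : 1 / √((n + 1 : ℕ) : ℝ) ≤ 2 * (√((n + 1 : ℕ) : ℝ) - √(n : ℝ)) := by
      rw [div_le_iff₀ h0]
      nlinarith [sq_nonneg (√((n + 1 : ℕ) : ℝ) - √(n : ℝ))]
    linarith

lemma sum_log_div_sq_le (n : ℕ) :
    ∑ i ∈ Finset.range n, (Real.log n - Real.log ((i + 1 : ℕ))) ^ 2 ≤ 32 * n := by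
  have h : ∀ i ∈ Finset.range n, (Real.log n - Real.log ((i + 1 : ℕ))) ^ 2 ≤
      16 * √n * (1 / √((i + 1 : ℕ) : ℝ)) := by
    intro i hi
    have hi : i + 1 ≤ n := Finset.mem_range.1 hi
    have hi' : ((i + 1 : ℕ) : ℝ) ≤ n := by exact_mod_cast hi
    have h0 : (0 : ℝ) < (i + 1 : ℕ) := by positivity
    rw [← Real.log_div (by linarith) h0.ne']
    refine (log_sq_le_sqrt ((one_le_div h0).2 hi')).trans (le_of_eq ?_)
    rw [Real.sqrt_div (by positivity)]
    ring
  refine (Finset.sum_le_sum h).trans ?_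
  rw [← Finset.mul_sum]
  have h1 := sum_one_div_sqrt_le n
  have h2 : √(n : ℝ) ^ 2 = n := Real.sq_sqrt (by positivity)
  nlinarith [mul_le_mul_of_nonneg_left h1 (Real.sqrt_nonneg (n : ℝ))]

lemma sum_nsrEntry_sq_le_of_lt {n i : ℕ} (hi : i < n) :
    Real.pi ^ 2 * ∑ p ∈ Finset.range (i + 1), nsrEntry (n - i) p ^ 2 ≤
      (Real.log n + 3.3499) ^ 2 - (Real.log n + 3.3499) *
        ((Real.log n - Real.log ((i + 1 : ℕ))) + (Real.log n - Real.log ((n - i : ℕ)))) +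
      (1 / 2 * (Real.log n - Real.log ((i + 1 : ℕ))) ^ 2 +
        42 * (Real.log n - Real.log ((n - i : ℕ))) ^ 2) + 122 := by
  have h := sum_nsrEntry_sq_le (a := n - i) (b := i + 1) (by omega) (by omega)
  have h1 : (0 : ℝ) < ((n - i : ℕ) : ℝ) := by
    have : 0 < n - i := by omega
    exact_mod_cast this
  have h2 : (0 : ℝ) < n := by
    have : 0 < n := by omega
    exact_mod_cast this
  rw [show n - i + (i + 1) - 1 = n by omega, Real.log_div h2.ne' h1.ne'] at h
  refine h.trans ?_
  set ℓ := Real.log n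
  set x := Real.log ((n - i : ℕ))
  set y := Real.log ((i + 1 : ℕ))
  nlinarith [sq_nonneg ((ℓ - x) - (ℓ - y)), sq_nonneg (ℓ - x - 1)]

lemma eventually_mean_nsrEntry_sq_le :
    ∀ᶠ n : ℕ in atTop, 1 / (n : ℝ) *
      ∑ i ∈ Finset.range n, ∑ p ∈ Finset.range (i + 1), nsrEntry (n - i) p ^ 2 ≤
        (0.748 + Real.log n / Real.pi) ^ 2 := by
  filter_upwards [tendsto_log_natCast.eventually_ge_atTop 200000000, eventually_ge_atTop 1]
    with n hl hn
  have hn' : (1 : ℝ) ≤ n := by exact_mod_cast hn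
  have hpi := Real.pi_pos
  have hpi6 := Real.pi_gt_d6
  have hsum := Finset.sum_le_sum fun i hi =>
    sum_nsrEntry_sq_le_of_lt (n := n) (i := i) (Finset.mem_range.1 hi)
  have hrefl : ∀ F : ℕ → ℝ, ∑ i ∈ Finset.range n, F (n - i) = ∑ i ∈ Finset.range n, F (i + 1) := by
    intro F
    rw [← Finset.sum_range_reflect (fun i => F (i + 1))]
    refine Finset.sum_congr rfl fun i hi => ?_
    have := Finset.mem_range.1 hi
    congr 1
    omega
  simp only [Finset.sum_add_distrib, Finset.sum_sub_distrib, ← Finset.mul_sum] at hsum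
  rw [hrefl fun k => Real.log k, hrefl fun k => (Real.log n - Real.log k) ^ 2] at hsum
  simp only [Finset.sum_const, Finset.card_range, nsmul_eq_mul] at hsum
  have hA : ∑ i ∈ Finset.range n, Real.log ((i + 1 : ℕ)) ≤
      n * Real.log n - n + Real.log n + 1 := by
    obtain ⟨m, rfl⟩ : ∃ m, n = m + 1 := ⟨n - 1, by omega⟩
    have := sum_log_le m
    push_cast at this ⊢
    exact this
  have hB := sum_log_div_sq_le n
  have hl2 : Real.log n ^ 2 ≤ 16 * n := by
    refine (log_sq_le_sqrt hn').trans ?_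
    have : √(n : ℝ) ≤ n := Real.sqrt_le_iff.2 ⟨by linarith, by nlinarith⟩
    linarith
  have hl1 : Real.log n ≤ n := (Real.log_le_sub_one_of_pos (by linarith)).trans (by linarith)
  rw [one_div, inv_mul_le_iff₀ (by linarith)]
  refine le_of_mul_le_mul_left (hsum.trans ?_) (by positivity : 0 < Real.pi ^ 2)
  have e : Real.pi ^ 2 * (n * (0.748 + Real.log n / Real.pi) ^ 2) =
      n * (Real.log n + 0.748 * Real.pi) ^ 2 := by
    field_simp
    ring
  rw [e]
  have hc : (Real.log n + 2.34991) ^ 2 ≤ (Real.log n + 0.748 * Real.pi) ^ 2 := by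
    gcongr
    linarith
  refine le_trans ?_ (mul_le_mul_of_nonneg_left hc (by linarith : (0 : ℝ) ≤ n))
  set ℓ := Real.log n
  set A := ∑ i ∈ Finset.range n, Real.log ((i + 1 : ℕ))
  set B := ∑ i ∈ Finset.range n, (ℓ - Real.log ((i + 1 : ℕ))) ^ 2
  have h1 : (ℓ + 3.3499) * A ≤ (ℓ + 3.3499) * (n * ℓ - n + ℓ + 1) := by gcongr
  have h2 : (ℓ + 3.3499) * (ℓ + 1) ≤ 25 * n := by nlinarith
  have h3 : (n : ℝ) * 200000000 ≤ n * ℓ := by gcongr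
  nlinarith

/-! ### Operator norms as row and column norms -/

lemma opNorm_nonneg (p q : ℝ≥0∞) [Fact (1 ≤ p)] [Fact (1 ≤ q)] {m k : ℕ}
    (A : Matrix (Fin m) (Fin k) ℝ) : 0 ≤ opNorm p q A := norm_nonneg _

lemma norm_toLp_le_opNorm (p q : ℝ≥0∞) [Fact (1 ≤ p)] [Fact (1 ≤ q)] {m k : ℕ}
    (A : Matrix (Fin m) (Fin k) ℝ) (x : Fin k → ℝ) :
    ‖WithLp.toLp q (A.mulVec x)‖ ≤ opNorm p q A * ‖WithLp.toLp p x‖ :=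
  (LinearMap.toContinuousLinearMap (Matrix.toLpLin p q A)).le_opNorm (WithLp.toLp p x)

lemma opNorm_le_of_forall (p q : ℝ≥0∞) [Fact (1 ≤ p)] [Fact (1 ≤ q)] {m k : ℕ}
    (A : Matrix (Fin m) (Fin k) ℝ) {c : ℝ} (hc : 0 ≤ c)
    (h : ∀ x : Fin k → ℝ, ‖WithLp.toLp q (A.mulVec x)‖ ≤ c * ‖WithLp.toLp p x‖) :
    opNorm p q A ≤ c :=
  ContinuousLinearMap.opNorm_le_bound _ hc fun x => h x.ofLp

lemma sum_row_sq_le_opNorm_sq {m k : ℕ} (A : Matrix (Fin m) (Fin k) ℝ) (i : Fin m) :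
    ∑ j, A i j ^ 2 ≤ opNorm 2 ∞ A ^ 2 := by
  have h := norm_toLp_le_opNorm 2 ∞ A (A i)
  have h1 := (PiLp.norm_apply_le (WithLp.toLp ∞ (A.mulVec (A i))) i).trans h
  have e : A.mulVec (A i) i = ∑ j, A i j ^ 2 := by
    simp [Matrix.mulVec, dotProduct, pow_two]
  rw [EuclideanSpace.norm_eq] at h1
  simp only [e, Real.norm_eq_abs, sq_abs] at h1
  have hS : 0 ≤ ∑ j, A i j ^ 2 := Finset.sum_nonneg fun _ _ => sq_nonneg _
  rw [abs_of_nonneg hS] at h1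
  have h2 := Real.sq_sqrt hS
  have h3 := Real.sqrt_nonneg (∑ j, A i j ^ 2)
  have h4 := opNorm_nonneg 2 ∞ A
  have h5 : √(∑ j, A i j ^ 2) ≤ opNorm 2 ∞ A := by
    rcases h3.eq_or_lt with h0 | h0
    · rwa [← h0]
    · exact le_of_mul_le_mul_right (by nlinarith) h0
  nlinarith

lemma opNorm_two_top_le {m k : ℕ} (A : Matrix (Fin m) (Fin k) ℝ) {c : ℝ} (hc : 0 ≤ c)
    (h : ∀ i, ∑ j, A i j ^ 2 ≤ c ^ 2) : opNorm 2 ∞ A ≤ c := by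
  refine opNorm_le_of_forall 2 ∞ A hc fun x => ?_
  rw [PiLp.norm_toLp]
  refine (pi_norm_le_iff_of_nonneg (by positivity)).2 fun i => ?_
  rw [EuclideanSpace.norm_eq, Real.norm_eq_abs]
  refine abs_le_of_sq_le_sq ?_ (by positivity)
  rw [mul_pow, Real.sq_sqrt (by positivity)]
  simp only [Real.norm_eq_abs, sq_abs]
  calc (A.mulVec x i) ^ 2 = (∑ j, A i j * x j) ^ 2 := rfl
    _ ≤ (∑ j, A i j ^ 2) * ∑ j, x j ^ 2 :=
        Finset.sum_mul_sq_le_sq_mul_sq _ _ _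
    _ ≤ _ := by
        gcongr
        exact h i

lemma sum_col_sq_le_opNorm_sq {m k : ℕ} (A : Matrix (Fin m) (Fin k) ℝ) (j : Fin k) :
    ∑ i, A i j ^ 2 ≤ opNorm 1 2 A ^ 2 := by
  have h := norm_toLp_le_opNorm 1 2 A (Pi.single j 1)
  have e : ‖WithLp.toLp 1 (Pi.single j (1 : ℝ) : Fin k → ℝ)‖ = 1 := by simp
  rw [e, mul_one, EuclideanSpace.norm_eq] at h
  have h2 := Real.sqrt_le_iff.1 h
  simpa using h2.2

lemma opNorm_one_two_le {m k : ℕ} (A : Matrix (Fin m) (Fin k) ℝ) {c : ℝ} (hc : 0 ≤ c)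
    (h : ∀ j, ∑ i, A i j ^ 2 ≤ c ^ 2) : opNorm 1 2 A ≤ c := by
  refine opNorm_le_of_forall 1 2 A hc fun x => ?_
  have e : WithLp.toLp 2 (A.mulVec x) = ∑ j, x j • WithLp.toLp 2 (fun i => A i j) := by
    ext i
    simp [Matrix.mulVec, dotProduct, mul_comm]
  have e1 : ‖WithLp.toLp 1 x‖ = ∑ j, |x j| := by simp [PiLp.norm_eq_of_L1]
  rw [e, e1, Finset.mul_sum]
  refine (norm_sum_le _ _).trans (Finset.sum_le_sum fun j _ => ?_)
  rw [norm_smul, mul_comm c, Real.norm_eq_abs, EuclideanSpace.norm_eq]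
  gcongr
  refine Real.sqrt_le_iff.2 ⟨hc, ?_⟩
  simpa using h j

/-! ### The normalized square root factorization -/

/-- Sums over a diagonal segment, as they occur in products of lower-triangular matrices. -/
lemma sum_fin_segment {n : ℕ} (i j : Fin n) (F : ℕ → ℝ) :
    ∑ m : Fin n, (if j ≤ m ∧ m ≤ i then F m else 0) =
      if j ≤ i then ∑ k ∈ Finset.range ((i : ℕ) - j + 1), F (j + k) else 0 := by
  have h := Fin.sum_univ_eq_sum_range
    (fun m : ℕ => if (j : ℕ) ≤ m ∧ m ≤ (i : ℕ) then F m else 0) n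
  simp only [Fin.le_def]
  rw [h, ← Finset.sum_filter]
  have e : (Finset.range n).filter (fun m => (j : ℕ) ≤ m ∧ m ≤ (i : ℕ)) =
      Finset.Ico (j : ℕ) (i + 1) := by
    ext m
    simp only [Finset.mem_filter, Finset.mem_range, Finset.mem_Ico]
    omega
  rw [e, Finset.sum_Ico_eq_sum_range]
  split_ifs with hij
  · rw [Nat.sub_add_comm hij]
  · rw [show (i : ℕ) + 1 - j = 0 by omega, Finset.sum_range_zero]

lemma sqrtMatrix_mul_self (n : ℕ) : sqrtMatrix n * sqrtMatrix n = countMatrix n := by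
  ext i j
  have h := sum_fin_segment i j fun m => sqrtCoeff (i - m) * sqrtCoeff (m - j)
  rw [Matrix.mul_apply]
  simp only [sqrtMatrix, countMatrix, Matrix.of_apply]
  refine Eq.trans (Finset.sum_congr rfl fun m _ => ?_) (h.trans ?_)
  · by_cases h1 : m ≤ i <;> by_cases h2 : j ≤ m <;> simp [h1, h2]
  · split_ifs with hij
    · rw [← sum_sqrtCoeff_mul_sqrtCoeff ((i : ℕ) - j)]
      refine Finset.sum_congr rfl fun k _ => ?_
      rw [Nat.add_sub_cancel_left, mul_comm, Nat.sub_add_eq]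
    · rfl

lemma sqrtColNorm_eq (n : ℕ) (j : Fin n) : sqrtColNorm n j = √(landau (n - j)) := by
  have hn : 0 < n := j.pos
  have h := sum_fin_segment (⟨n - 1, by omega⟩ : Fin n) j fun m => sqrtCoeff (m - j) ^ 2
  have hj : j ≤ (⟨n - 1, by omega⟩ : Fin n) := Fin.le_def.2 (by have := j.2; simp; omega)
  rw [if_pos hj] at h
  rw [sqrtColNorm, landau]
  congr 1
  refine Eq.trans (Finset.sum_congr rfl fun m _ => ?_) (h.trans ?_)
  · have hm : m ≤ (⟨n - 1, by omega⟩ : Fin n) := Fin.le_def.2 (by have := m.2; simp; omega)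
    by_cases h2 : j ≤ m <;> simp [sqrtMatrix, hm, h2]
  · simp only [Nat.add_sub_cancel_left]
    congr 2
    have := j.2
    omega

lemma sqrtColNorm_pos (n : ℕ) (j : Fin n) : 0 < sqrtColNorm n j := by
  rw [sqrtColNorm_eq, Real.sqrt_pos]
  have := j.2
  linarith [one_le_landau (t := n - j) (by omega)]

lemma diagonal_sqrtColNorm_inv (n : ℕ) :
    (Matrix.diagonal (sqrtColNorm n))⁻¹ = Matrix.diagonal fun j => (sqrtColNorm n j)⁻¹ := by
  refine Matrix.inv_eq_right_inv ?_
  rw [Matrix.diagonal_mul_diagonal, ← Matrix.diagonal_one]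
  congr 1
  ext j
  exact mul_inv_cancel₀ (sqrtColNorm_pos n j).ne'

/-- The lower-triangular Toeplitz matrix of `(1 - x)^(1/2)`, the inverse of `sqrtMatrix n`. -/
noncomputable def sqrtInvMatrix (n : ℕ) : Matrix (Fin n) (Fin n) ℝ :=
  Matrix.of fun i j => if j ≤ i then sqrtInvCoeff ((i : ℕ) - (j : ℕ)) else 0

lemma sum_sqrtInvCoeff_mul_sqrtCoeff (m : ℕ) :
    ∑ k ∈ Finset.range (m + 1), sqrtInvCoeff k * sqrtCoeff (m - k) = if m = 0 then 1 else 0 := by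
  rcases m with _ | m
  · simp [sqrtInvCoeff, sqrtCoeff_zero]
  · have h1 := sum_sqrtCoeff_mul_sqrtCoeff (m + 1)
    have h2 := sum_sqrtCoeff_mul_sqrtCoeff m
    rw [Finset.sum_range_succ'] at h1 ⊢
    simp only [sqrtInvCoeff, Nat.add_sub_add_right, sub_mul, Finset.sum_sub_distrib,
      sqrtCoeff_zero] at h1 h2 ⊢
    simp only [Nat.add_eq_zero_iff, one_ne_zero, and_false, if_false]
    linarith

lemma sqrtMatrix_mul_sqrtInvMatrix (n : ℕ) : sqrtMatrix n * sqrtInvMatrix n = 1 := by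
  ext i j
  have h := sum_fin_segment i j fun m => sqrtCoeff (i - m) * sqrtInvCoeff (m - j)
  rw [Matrix.mul_apply, Matrix.one_apply]
  simp only [sqrtMatrix, sqrtInvMatrix, Matrix.of_apply]
  refine Eq.trans (Finset.sum_congr rfl fun m _ => ?_) (h.trans ?_)
  · by_cases h1 : m ≤ i <;> by_cases h2 : j ≤ m <;> simp [h1, h2]
  · split_ifs with hij hij' hij'
    · subst hij'
      simp [sqrtInvCoeff, sqrtCoeff_zero]
    · have e := sum_sqrtInvCoeff_mul_sqrtCoeff ((i : ℕ) - j)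
      rw [if_neg (by have := Fin.val_ne_of_ne hij'; have := Fin.le_def.1 hij; omega)] at e
      rw [← e]
      refine Finset.sum_congr rfl fun k _ => ?_
      rw [Nat.add_sub_cancel_left, mul_comm, Nat.sub_add_eq]
    · exact absurd hij'.ge hij
    · rfl

lemma isUnit_nsrRight_det (n : ℕ) : IsUnit (nsrRight n).det := by
  have h1 : IsUnit (sqrtMatrix n).det := (Matrix.isUnit_iff_isUnit_det _).1
    (IsUnit.of_mul_eq_one _ (sqrtMatrix_mul_sqrtInvMatrix n))
  rw [nsrRight, diagonal_sqrtColNorm_inv, Matrix.det_mul, Matrix.det_diagonal]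
  exact h1.mul (isUnit_iff_ne_zero.2
    (Finset.prod_ne_zero_iff.2 fun j _ => inv_ne_zero (sqrtColNorm_pos n j).ne'))

lemma nsrLeft_mul_nsrRight (n : ℕ) : nsrLeft n * nsrRight n = countMatrix n := by
  rw [nsrLeft, Matrix.mul_assoc, Matrix.nonsing_inv_mul _ (isUnit_nsrRight_det n),
    Matrix.mul_one]

lemma nsrLeft_eq (n : ℕ) :
    nsrLeft n = countMatrix n * (Matrix.diagonal (sqrtColNorm n) * sqrtInvMatrix n) := by
  have h : (nsrRight n)⁻¹ = Matrix.diagonal (sqrtColNorm n) * sqrtInvMatrix n := by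
    refine Matrix.inv_eq_right_inv ?_
    have hd : (Matrix.diagonal (sqrtColNorm n))⁻¹ * Matrix.diagonal (sqrtColNorm n) = 1 := by
      rw [diagonal_sqrtColNorm_inv, Matrix.diagonal_mul_diagonal, ← Matrix.diagonal_one]
      congr 1
      ext j
      exact inv_mul_cancel₀ (sqrtColNorm_pos n j).ne'
    rw [nsrRight, Matrix.mul_assoc, ← Matrix.mul_assoc _ _ (sqrtInvMatrix n), hd,
      Matrix.one_mul, sqrtMatrix_mul_sqrtInvMatrix]
  rw [nsrLeft, h]

lemma nsrLeft_apply (n : ℕ) (i j : Fin n) :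
    nsrLeft n i j = if j ≤ i then nsrEntry (n - i) (i - j) else 0 := by
  have h := sum_fin_segment i j fun m => √(landau (n - m)) * sqrtInvCoeff (m - j)
  rw [nsrLeft_eq, Matrix.mul_apply]
  simp only [countMatrix, sqrtInvMatrix, Matrix.of_apply, Matrix.diagonal_mul, sqrtColNorm_eq]
  refine Eq.trans (Finset.sum_congr rfl fun m _ => ?_) (h.trans ?_)
  · by_cases h1 : m ≤ i <;> by_cases h2 : j ≤ m <;> simp [h1, h2]
  · split_ifs with hij
    · rw [nsrEntry]
      refine Finset.sum_congr rfl fun k hk => ?_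
      have hi := i.2
      have hij' := Fin.le_def.1 hij
      have hk := Finset.mem_range.1 hk
      rw [Nat.add_sub_cancel_left, mul_comm]
      congr 3
      omega
    · rfl

lemma sum_nsrLeft_row_sq (n : ℕ) (i : Fin n) :
    ∑ j, nsrLeft n i j ^ 2 = ∑ p ∈ Finset.range (i + 1), nsrEntry (n - i) p ^ 2 := by
  have hn : 0 < n := i.pos
  have h := sum_fin_segment i (⟨0, hn⟩ : Fin n) fun j => nsrEntry (n - i) (i - j) ^ 2
  rw [if_pos (Fin.le_def.2 (Nat.zero_le _))] at h
  rw [← Finset.sum_range_reflect]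
  refine Eq.trans (Finset.sum_congr rfl fun j _ => ?_) (h.trans ?_)
  · have hj : (⟨0, hn⟩ : Fin n) ≤ j := Fin.le_def.2 (Nat.zero_le _)
    by_cases h1 : j ≤ i <;> simp [nsrLeft_apply, h1, hj]
  · simp

lemma sum_nsrRight_col_sq (n : ℕ) (j : Fin n) : ∑ i, nsrRight n i j ^ 2 = 1 := by
  have h0 := sqrtColNorm_pos n j
  have h : sqrtColNorm n j ^ 2 = ∑ i, sqrtMatrix n i j ^ 2 :=
    Real.sq_sqrt (Finset.sum_nonneg fun _ _ => sq_nonneg _)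
  simp only [nsrRight, diagonal_sqrtColNorm_inv, Matrix.mul_diagonal, mul_pow]
  rw [← Finset.sum_mul, ← h, inv_pow, mul_inv_cancel₀ (by positivity)]

lemma opNorm_nsrRight_le (n : ℕ) : opNorm 1 2 (nsrRight n) ≤ 1 :=
  opNorm_one_two_le _ zero_le_one fun j => by rw [sum_nsrRight_col_sq]; norm_num

lemma eventually_opNorm_nsr_le :
    ∀ᶠ n : ℕ in atTop, opNorm 2 ∞ (nsrLeft n) * opNorm 1 2 (nsrRight n) ≤
      0.846 + Real.log n / Real.pi := by
  filter_upwards [eventually_sum_nsrEntry_sq_le, eventually_ge_atTop 1] with n h hn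
  have hlog : 0 ≤ Real.log n := Real.log_nonneg (by exact_mod_cast hn)
  have hc : 0 ≤ 0.846 + Real.log n / Real.pi := by positivity
  refine (mul_le_of_le_one_right (opNorm_nonneg _ _ _) (opNorm_nsrRight_le n)).trans ?_
  refine opNorm_two_top_le _ hc fun i => ?_
  rw [sum_nsrLeft_row_sq]
  have hi := i.2
  exact h (n - i) (i + 1) (by omega) (by omega) (by omega)

lemma eventually_frobNorm_nsr_le :
    ∀ᶠ n : ℕ in atTop, 1 / √(n : ℝ) * frobNorm (nsrLeft n) * opNorm 1 2 (nsrRight n) ≤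
      0.748 + Real.log n / Real.pi := by
  filter_upwards [eventually_mean_nsrEntry_sq_le, eventually_ge_atTop 1] with n h hn
  have hlog : 0 ≤ Real.log n := Real.log_nonneg (by exact_mod_cast hn)
  have hc : 0 ≤ 0.748 + Real.log n / Real.pi := by positivity
  have hF : 0 ≤ frobNorm (nsrLeft n) := Real.sqrt_nonneg _
  refine (mul_le_of_le_one_right (by positivity) (opNorm_nsrRight_le n)).trans ?_
  rw [frobNorm, one_div, ← Real.sqrt_inv, ← Real.sqrt_mul (by positivity)]
  refine Real.sqrt_le_iff.2 ⟨hc, ?_⟩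
  simp only [sum_nsrLeft_row_sq]
  rw [Fin.sum_univ_eq_sum_range
    (fun i => ∑ p ∈ Finset.range (i + 1), nsrEntry (n - i) p ^ 2) n, ← one_div]
  exact h

/-! ### Lower bounds for factorization norms by trace duality -/

lemma frobNorm_nonneg {m k : ℕ} (A : Matrix (Fin m) (Fin k) ℝ) : 0 ≤ frobNorm A :=
  Real.sqrt_nonneg _

lemma frobNorm_sq {m k : ℕ} (A : Matrix (Fin m) (Fin k) ℝ) :
    frobNorm A ^ 2 = ∑ i, ∑ j, A i j ^ 2 :=
  Real.sq_sqrt (Finset.sum_nonneg fun _ _ => Finset.sum_nonneg fun _ _ => sq_nonneg _)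

lemma frobNorm_sq_eq_trace {m k : ℕ} (A : Matrix (Fin m) (Fin k) ℝ) :
    frobNorm A ^ 2 = (A.transpose * A).trace := by
  rw [frobNorm_sq, Finset.sum_comm]
  simp [Matrix.trace, Matrix.mul_apply, pow_two]

lemma frobNorm_transpose {m k : ℕ} (A : Matrix (Fin m) (Fin k) ℝ) :
    frobNorm A.transpose = frobNorm A := by
  rw [frobNorm, Finset.sum_comm]
  rfl

lemma trace_mul_le_frobNorm {m k : ℕ} (A : Matrix (Fin m) (Fin k) ℝ)
    (B : Matrix (Fin k) (Fin m) ℝ) : (A * B).trace ≤ frobNorm A * frobNorm B := by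
  have h := Real.sum_mul_le_sqrt_mul_sqrt (Finset.univ : Finset (Fin m × Fin k))
    (fun p => A p.1 p.2) (fun p => B p.2 p.1)
  simp only [Fintype.sum_prod_type] at h
  have e : frobNorm B = √(∑ i, ∑ j, B j i ^ 2) := by rw [frobNorm, Finset.sum_comm]
  rw [e]
  simpa [Matrix.trace, Matrix.mul_apply, frobNorm] using h

lemma frobNorm_transpose_mul_sq {n k : ℕ} {c : ℝ} (hc : c ≠ 0) {S : Matrix (Fin n) (Fin n) ℝ}
    (hS : S.transpose * S = c • (1 : Matrix (Fin n) (Fin n) ℝ)) (L : Matrix (Fin n) (Fin k) ℝ) :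
    frobNorm (S.transpose * L) ^ 2 = c * frobNorm L ^ 2 := by
  have h1 : (c⁻¹ • S.transpose) * S = 1 := by
    rw [Matrix.smul_mul, hS, smul_smul, inv_mul_cancel₀ hc, one_smul]
  have h2 : S * S.transpose = c • (1 : Matrix (Fin n) (Fin n) ℝ) := by
    have h3 := mul_eq_one_comm.1 h1
    rw [Matrix.mul_smul] at h3
    rw [← h3, smul_smul, mul_inv_cancel₀ hc, one_smul]
  rw [frobNorm_sq_eq_trace, frobNorm_sq_eq_trace, Matrix.transpose_mul, Matrix.transpose_transpose,
    Matrix.mul_assoc, ← Matrix.mul_assoc S, h2, Matrix.smul_mul, Matrix.one_mul, Matrix.mul_smul,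
    Matrix.trace_smul, smul_eq_mul]

/-- If `A` has singular values `σ`, with left and right singular vectors the columns of `S` and
`C` (all of Euclidean norm `√c`), then its nuclear norm is a lower bound for `‖L‖_F ‖R‖_F`. -/
lemma sum_le_frobNorm_mul_frobNorm {n k : ℕ} {c : ℝ} (hc : 0 < c)
    {A S C : Matrix (Fin n) (Fin n) ℝ} {σ : Fin n → ℝ}
    (hS : S.transpose * S = c • (1 : Matrix (Fin n) (Fin n) ℝ))
    (hC : C.transpose * C = c • (1 : Matrix (Fin n) (Fin n) ℝ))
    (hA : A * C = S * Matrix.diagonal σ)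
    {L : Matrix (Fin n) (Fin k) ℝ} {R : Matrix (Fin k) (Fin n) ℝ} (hLR : A = L * R) :
    ∑ j, σ j ≤ frobNorm L * frobNorm R := by
  have h1 : ((S.transpose * L) * (R * C)).trace = c * ∑ j, σ j := by
    rw [Matrix.mul_assoc, ← Matrix.mul_assoc L, ← hLR, hA, ← Matrix.mul_assoc, hS,
      Matrix.smul_mul, Matrix.one_mul, Matrix.trace_smul, Matrix.trace_diagonal, smul_eq_mul]
  have h2 := trace_mul_le_frobNorm (S.transpose * L) (R * C)
  have h3 : frobNorm (S.transpose * L) = √c * frobNorm L := by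
    rw [← Real.sqrt_sq (frobNorm_nonneg (S.transpose * L)), frobNorm_transpose_mul_sq hc.ne' hS,
      Real.sqrt_mul hc.le, Real.sqrt_sq (frobNorm_nonneg L)]
  have h4 : frobNorm (R * C) = √c * frobNorm R := by
    rw [← frobNorm_transpose, ← frobNorm_transpose R, Matrix.transpose_mul,
      ← Real.sqrt_sq (frobNorm_nonneg (C.transpose * R.transpose)),
      frobNorm_transpose_mul_sq hc.ne' hC, Real.sqrt_mul hc.le,
      Real.sqrt_sq (frobNorm_nonneg R.transpose)]
  rw [h1, h3, h4] at h2
  have h5 : √c * frobNorm L * (√c * frobNorm R) = c * (frobNorm L * frobNorm R) := by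
    rw [← Real.mul_self_sqrt hc.le]
    simp only [Real.sqrt_mul_self (Real.sqrt_nonneg c)]
    ring
  rw [h5] at h2
  exact le_of_mul_le_mul_left h2 hc

lemma frobNorm_le_sqrt_mul_opNorm_one_two {n k : ℕ} (R : Matrix (Fin k) (Fin n) ℝ) :
    frobNorm R ≤ √n * opNorm 1 2 R := by
  refine Real.sqrt_le_iff.2 ⟨mul_nonneg (Real.sqrt_nonneg _) (opNorm_nonneg _ _ _), ?_⟩
  rw [Finset.sum_comm, mul_pow, Real.sq_sqrt (by positivity)]
  refine (Finset.sum_le_sum fun j _ => sum_col_sq_le_opNorm_sq R j).trans ?_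
  simp

lemma frobNorm_le_sqrt_mul_opNorm_two_top {n k : ℕ} (L : Matrix (Fin n) (Fin k) ℝ) :
    frobNorm L ≤ √n * opNorm 2 ∞ L := by
  refine Real.sqrt_le_iff.2 ⟨mul_nonneg (Real.sqrt_nonneg _) (opNorm_nonneg _ _ _), ?_⟩
  rw [mul_pow, Real.sq_sqrt (by positivity)]
  refine (Finset.sum_le_sum fun i _ => sum_row_sq_le_opNorm_sq L i).trans ?_
  simp

/-! ### Singular value decomposition of the counting matrix -/

lemma two_sin_mul_sum_cos (φ : ℝ) (n : ℕ) :
    2 * Real.sin (φ / 2) * ∑ k ∈ Finset.range n, Real.cos ((k + 1 / 2) * φ) =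
      Real.sin (n * φ) := by
  induction n with
  | zero => simp
  | succ n ih =>
    rw [Finset.sum_range_succ, mul_add, ih]
    have h1 : ((n + 1 : ℕ) : ℝ) * φ = (n + 1 / 2) * φ + φ / 2 := by
      push_cast
      ring
    have h2 : (n : ℝ) * φ = (n + 1 / 2) * φ - φ / 2 := by ring
    rw [h1, h2, Real.sin_add, Real.sin_sub]
    ring

lemma two_sin_mul_sum_cos_succ (φ : ℝ) (n : ℕ) :
    2 * Real.sin (φ / 2) * ∑ k ∈ Finset.range n, Real.cos ((k + 1) * φ) =
      Real.sin ((n + 1 / 2) * φ) - Real.sin (φ / 2) := by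
  induction n with
  | zero =>
    rw [show ((0 : ℕ) + 1 / 2 : ℝ) * φ = φ / 2 by push_cast; ring]
    simp
  | succ n ih =>
    rw [Finset.sum_range_succ, mul_add, ih]
    have h1 : ((n + 1 : ℕ) + 1 / 2 : ℝ) * φ = (n + 1) * φ + φ / 2 := by
      push_cast
      ring
    have h2 : (n + 1 / 2 : ℝ) * φ = (n + 1) * φ - φ / 2 := by ring
    rw [h1, h2, Real.sin_add, Real.sin_sub]
    ring

lemma sin_pi_mul_div_ne_zero {n : ℕ} {m : ℤ} (hm0 : m ≠ 0) (hm1 : |m| < 2 * n + 1) :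
    Real.sin (Real.pi * m / (2 * n + 1)) ≠ 0 := by
  intro h
  obtain ⟨k, hk⟩ := Real.sin_eq_zero_iff.1 h
  have hpi := Real.pi_pos
  have hN : (0 : ℝ) < 2 * n + 1 := by positivity
  have h1 : (k : ℝ) * (2 * n + 1) = m := by
    rw [eq_div_iff hN.ne'] at hk
    have h2 : Real.pi * ((k : ℝ) * (2 * n + 1)) = Real.pi * m := by linarith
    exact mul_left_cancel₀ hpi.ne' h2
  have h2 : k * (2 * n + 1) = m := by exact_mod_cast h1
  have hdvd : (2 * n + 1 : ℤ) ∣ m := ⟨k, by linarith⟩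
  exact hm0 (Int.eq_zero_of_abs_lt_dvd hdvd hm1)

lemma sum_cos_succ_eq {n : ℕ} {m : ℤ} (hm0 : m ≠ 0) (hm1 : |m| < 2 * n + 1) :
    ∑ k ∈ Finset.range n, Real.cos ((k + 1) * (2 * Real.pi * m / (2 * n + 1))) = -1 / 2 := by
  have h := two_sin_mul_sum_cos_succ (2 * Real.pi * m / (2 * n + 1)) n
  have hs := sin_pi_mul_div_ne_zero hm0 hm1
  have e1 : 2 * Real.pi * m / (2 * n + 1) / 2 = Real.pi * m / (2 * n + 1) := by ring
  have e2 : (n + 1 / 2 : ℝ) * (2 * Real.pi * m / (2 * n + 1)) = m * Real.pi := by field_simp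
  rw [e1, e2, Real.sin_int_mul_pi] at h
  have h2 : Real.sin (Real.pi * m / (2 * n + 1)) *
      (2 * ∑ k ∈ Finset.range n, Real.cos ((k + 1) * (2 * Real.pi * m / (2 * n + 1)))) =
      Real.sin (Real.pi * m / (2 * n + 1)) * (-1) := by linarith
  have h3 := mul_left_cancel₀ hs h2
  linarith

lemma sum_cos_half_eq {n : ℕ} {m : ℤ} (hm0 : m ≠ 0) (hm1 : |m| < 2 * n + 1) :
    ∑ k ∈ Finset.range n, Real.cos ((k + 1 / 2) * (2 * Real.pi * m / (2 * n + 1))) =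
      -Real.cos (m * Real.pi) / 2 := by
  have h := two_sin_mul_sum_cos (2 * Real.pi * m / (2 * n + 1)) n
  have hs := sin_pi_mul_div_ne_zero hm0 hm1
  have e1 : 2 * Real.pi * m / (2 * n + 1) / 2 = Real.pi * m / (2 * n + 1) := by ring
  have e2 : (n : ℝ) * (2 * Real.pi * m / (2 * n + 1)) =
      m * Real.pi - Real.pi * m / (2 * n + 1) := by
    field_simp
    ring
  rw [e1, e2, Real.sin_sub, Real.sin_int_mul_pi] at h
  have h2 : Real.sin (Real.pi * m / (2 * n + 1)) *
      (2 * ∑ k ∈ Finset.range n, Real.cos ((k + 1 / 2) * (2 * Real.pi * m / (2 * n + 1)))) =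
      Real.sin (Real.pi * m / (2 * n + 1)) * (-Real.cos (m * Real.pi)) := by linarith
  have h3 := mul_left_cancel₀ hs h2
  linarith

/-- The angles `θ_j = (2 j + 1) π / (2 n + 1)`; the singular values of `countMatrix n` are
`1 / (2 sin (θ_j / 2))`. -/
noncomputable def countAngle (n j : ℕ) : ℝ := (2 * j + 1) * Real.pi / (2 * n + 1)

/-- Left singular vectors of `countMatrix n`, as columns. -/
noncomputable def countSin (n : ℕ) : Matrix (Fin n) (Fin n) ℝ :=
  Matrix.of fun k j => Real.sin (((k : ℕ) + 1) * countAngle n j)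

/-- Right singular vectors of `countMatrix n`, as columns. -/
noncomputable def countCos (n : ℕ) : Matrix (Fin n) (Fin n) ℝ :=
  Matrix.of fun k j => Real.cos (((k : ℕ) + 1 / 2) * countAngle n j)

lemma countAngle_sub (n i j : ℕ) : countAngle n i - countAngle n j =
    2 * Real.pi * ((i : ℤ) - j : ℤ) / (2 * n + 1) := by
  rw [countAngle, countAngle]
  push_cast
  ring

lemma countAngle_add (n i j : ℕ) : countAngle n i + countAngle n j =
    2 * Real.pi * ((i : ℤ) + j + 1 : ℤ) / (2 * n + 1) := by
  rw [countAngle, countAngle]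
  push_cast
  ring

lemma countSin_transpose_mul_self (n : ℕ) : (countSin n).transpose * countSin n =
    ((2 * n + 1) / 4 : ℝ) • (1 : Matrix (Fin n) (Fin n) ℝ) := by
  ext i j
  have hi := i.2
  have hj := j.2
  have e : ∀ k : ℕ, Real.sin ((k + 1) * countAngle n i) * Real.sin ((k + 1) * countAngle n j) =
      1 / 2 * (Real.cos ((k + 1) * (countAngle n i - countAngle n j)) -
        Real.cos ((k + 1) * (countAngle n i + countAngle n j))) := by
    intro k
    rw [mul_sub ((k : ℝ) + 1), mul_add ((k : ℝ) + 1), Real.cos_sub, Real.cos_add]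
    ring
  have hp := sum_cos_succ_eq (n := n) (m := (i : ℤ) + j + 1) (by omega) (by
    rw [abs_lt]
    omega)
  simp only [Matrix.mul_apply, Matrix.transpose_apply, countSin, Matrix.of_apply, e]
  rw [← Finset.mul_sum, Finset.sum_sub_distrib,
    Fin.sum_univ_eq_sum_range (fun k => Real.cos ((k + 1) * (countAngle n i - countAngle n j))),
    Fin.sum_univ_eq_sum_range (fun k => Real.cos ((k + 1) * (countAngle n i + countAngle n j))),
    countAngle_add, hp, Matrix.smul_apply, Matrix.one_apply]
  split_ifs with hij
  · subst hij
    simp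
    ring
  · have hm := sum_cos_succ_eq (n := n) (m := (i : ℤ) - j)
      (by have := Fin.val_ne_of_ne hij; omega) (by
        rw [abs_lt]
        omega)
    rw [countAngle_sub, hm]
    simp

lemma countCos_transpose_mul_self (n : ℕ) : (countCos n).transpose * countCos n =
    ((2 * n + 1) / 4 : ℝ) • (1 : Matrix (Fin n) (Fin n) ℝ) := by
  ext i j
  have hi := i.2
  have hj := j.2
  have e : ∀ k : ℕ,
      Real.cos ((k + 1 / 2) * countAngle n i) * Real.cos ((k + 1 / 2) * countAngle n j) =
      1 / 2 * (Real.cos ((k + 1 / 2) * (countAngle n i - countAngle n j)) +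
        Real.cos ((k + 1 / 2) * (countAngle n i + countAngle n j))) := by
    intro k
    rw [mul_sub ((k : ℝ) + 1 / 2), mul_add ((k : ℝ) + 1 / 2), Real.cos_sub, Real.cos_add]
    ring
  have hp := sum_cos_half_eq (n := n) (m := (i : ℤ) + j + 1) (by omega) (by
    rw [abs_lt]
    omega)
  -- The integers `i + j + 1` and `i - j` have opposite parity.
  have hpar : Real.cos (((i : ℤ) + j + 1 : ℤ) * Real.pi) =
      -Real.cos (((i : ℤ) - j : ℤ) * Real.pi) := by
    have h1 : (((i : ℤ) + j + 1 : ℤ) : ℝ) * Real.pi =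
        (((i : ℤ) - j : ℤ) : ℝ) * Real.pi + Real.pi + (j : ℕ) * (2 * Real.pi) := by
      push_cast
      ring
    rw [h1, Real.cos_add_nat_mul_two_pi, Real.cos_add_pi]
  simp only [Matrix.mul_apply, Matrix.transpose_apply, countCos, Matrix.of_apply, e]
  rw [← Finset.mul_sum, Finset.sum_add_distrib,
    Fin.sum_univ_eq_sum_range
      (fun k => Real.cos ((k + 1 / 2) * (countAngle n i - countAngle n j))),
    Fin.sum_univ_eq_sum_range
      (fun k => Real.cos ((k + 1 / 2) * (countAngle n i + countAngle n j))),
    countAngle_add, hp, hpar, Matrix.smul_apply, Matrix.one_apply]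
  split_ifs with hij
  · subst hij
    simp
    ring
  · have hm := sum_cos_half_eq (n := n) (m := (i : ℤ) - j)
      (by have := Fin.val_ne_of_ne hij; omega) (by
        rw [abs_lt]
        omega)
    rw [countAngle_sub, hm]
    simp
    ring

lemma countAngle_half_pos (n j : ℕ) : 0 < countAngle n j / 2 := by
  have := Real.pi_pos
  unfold countAngle
  positivity

lemma countAngle_half_le {n j : ℕ} (hj : j < n) : countAngle n j / 2 ≤ Real.pi / 2 := by
  have := Real.pi_pos
  have hj' : (j : ℝ) + 1 ≤ n := by exact_mod_cast hj
  unfold countAngle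
  gcongr
  rw [div_le_iff₀ (by positivity)]
  nlinarith

lemma sin_countAngle_half_pos {n j : ℕ} (hj : j < n) : 0 < Real.sin (countAngle n j / 2) :=
  Real.sin_pos_of_pos_of_lt_pi (countAngle_half_pos n j)
    (by linarith [countAngle_half_le hj, Real.pi_pos])

lemma countMatrix_mul_countCos (n : ℕ) : countMatrix n * countCos n =
    countSin n * Matrix.diagonal fun j : Fin n => 1 / (2 * Real.sin (countAngle n j / 2)) := by
  ext i j
  have hs := sin_countAngle_half_pos j.2
  have h := sum_fin_segment i (⟨0, i.pos⟩ : Fin n)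
    fun m => Real.cos ((m + 1 / 2) * countAngle n j)
  rw [if_pos (Fin.le_def.2 (Nat.zero_le _))] at h
  rw [Matrix.mul_diagonal, Matrix.mul_apply]
  have e : ∑ m, countMatrix n i m * countCos n m j =
      ∑ k ∈ Finset.range ((i : ℕ) + 1), Real.cos ((k + 1 / 2) * countAngle n j) := by
    refine Eq.trans (Finset.sum_congr rfl fun m _ => ?_) (h.trans ?_)
    · have hm : (⟨0, i.pos⟩ : Fin n) ≤ m := Fin.le_def.2 (Nat.zero_le _)
      by_cases h1 : m ≤ i <;> simp [countMatrix, countCos, h1, hm]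
    · simp
  have h2 := two_sin_mul_sum_cos (countAngle n j) (i + 1)
  rw [e, mul_one_div, eq_div_iff (by positivity)]
  push_cast at h2
  simp only [countSin, Matrix.of_apply]
  linarith

/-! ### The sum of the singular values -/

/-- The primitive `log (tan (x / 2)) - log x` of `1 / sin x - 1 / x`. -/
noncomputable def cscPrimitive (x : ℝ) : ℝ :=
  Real.log (Real.sin (x / 2)) - Real.log (Real.cos (x / 2)) - Real.log x

lemma hasDerivAt_cscPrimitive {x : ℝ} (hx0 : 0 < x) (hx : x ≤ Real.pi / 2) :
    HasDerivAt cscPrimitive (1 / Real.sin x - 1 / x) x := by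
  have hs : 0 < Real.sin (x / 2) :=
    Real.sin_pos_of_pos_of_lt_pi (by linarith) (by linarith [Real.pi_pos])
  have hc : 0 < Real.cos (x / 2) :=
    Real.cos_pos_of_mem_Ioo ⟨by linarith [Real.pi_pos], by linarith [Real.pi_pos]⟩
  have h2 : HasDerivAt (fun x : ℝ => x / 2) (1 / 2) x := (hasDerivAt_id x).div_const 2
  have h := ((h2.sin.log hs.ne').sub (h2.cos.log hc.ne')).sub ((hasDerivAt_id x).log hx0.ne')
  refine h.congr_deriv ?_
  have e : Real.sin x = 2 * Real.sin (x / 2) * Real.cos (x / 2) := by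
    rw [← Real.sin_two_mul]
    congr 1
    ring
  rw [e]
  simp only [id]
  field_simp
  nlinarith [Real.sin_sq_add_cos_sq (x / 2)]

lemma sq_mul_cos_le_sin_sq {x : ℝ} (hx0 : 0 < x) (hx : x ≤ Real.pi / 2) :
    x ^ 2 * Real.cos x ≤ Real.sin x ^ 2 := by
  have hpi := Real.pi_pos
  set y := x / 2 with hy
  have hc : 0 < Real.cos y :=
    Real.cos_pos_of_mem_Ioo ⟨by linarith, by linarith⟩
  have ht : y * Real.cos y ≤ Real.sin y := by
    have h := Real.le_tan (x := y) (by linarith) (by linarith)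
    rwa [Real.tan_eq_sin_div_cos, le_div_iff₀ hc] at h
  have e1 : Real.sin x = 2 * Real.sin y * Real.cos y := by
    rw [← Real.sin_two_mul, hy]
    congr 1
    ring
  have e2 : Real.cos x = Real.cos y ^ 2 - Real.sin y ^ 2 := by
    rw [← Real.cos_two_mul', hy]
    congr 1
    ring
  have e3 : x = 2 * y := by
    rw [hy]
    ring
  have h1 : Real.cos y ^ 2 - Real.sin y ^ 2 ≤ Real.cos y ^ 4 := by
    have := Real.sin_sq_add_cos_sq y
    nlinarith [sq_nonneg (Real.sin y ^ 2)]
  have h2 : (y * Real.cos y) ^ 2 ≤ Real.sin y ^ 2 :=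
    pow_le_pow_left₀ (mul_nonneg (by linarith) hc.le) ht 2
  rw [e1, e2, e3]
  nlinarith [mul_le_mul_of_nonneg_left h1 (sq_nonneg y),
    mul_le_mul_of_nonneg_right h2 (sq_nonneg (Real.cos y))]

lemma csc_sub_inv_monotoneOn :
    MonotoneOn (fun x => 1 / Real.sin x - 1 / x) (Set.Ioc 0 (Real.pi / 2)) := by
  have hd : ∀ x ∈ Set.Ioc 0 (Real.pi / 2), HasDerivAt (fun x => 1 / Real.sin x - 1 / x)
      (-Real.cos x / Real.sin x ^ 2 - -1 / x ^ 2) x := by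
    intro x hx
    have hs : 0 < Real.sin x :=
      Real.sin_pos_of_pos_of_lt_pi hx.1 (by linarith [hx.2, Real.pi_pos])
    have h1 := (Real.hasDerivAt_sin x).fun_inv hs.ne'
    have h2 := (hasDerivAt_id x).fun_inv hx.1.ne'
    simpa only [one_div, id] using h1.fun_sub h2
  refine monotoneOn_of_deriv_nonneg (convex_Ioc _ _)
    (fun x hx => (hd x hx).continuousAt.continuousWithinAt)
    (fun x hx => (hd x (interior_subset hx)).differentiableAt.differentiableWithinAt) ?_
  intro x hx
  have hx := interior_subset hx
  have hs : 0 < Real.sin x :=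
    Real.sin_pos_of_pos_of_lt_pi hx.1 (by linarith [hx.2, Real.pi_pos])
  have hx0 := hx.1
  rw [(hd x hx).deriv, neg_div, neg_div, sub_neg_eq_add, neg_add_eq_sub, sub_nonneg,
    div_le_div_iff₀ (by positivity) (by positivity), one_mul, mul_comm]
  exact sq_mul_cos_le_sin_sq hx.1 hx.2

lemma cscPrimitive_sub_le {x y : ℝ} (hx : 0 < x) (hxy : x < y) (hy : y ≤ Real.pi / 2) :
    cscPrimitive y - cscPrimitive x ≤ (1 / Real.sin y - 1 / y) * (y - x) := by
  have hd : ∀ z, x ≤ z → z ≤ y → HasDerivAt cscPrimitive (1 / Real.sin z - 1 / z) z :=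
    fun z h1 h2 => hasDerivAt_cscPrimitive (hx.trans_le h1) (h2.trans hy)
  obtain ⟨z, hz, he⟩ := exists_hasDerivAt_eq_slope cscPrimitive
    (fun z => 1 / Real.sin z - 1 / z) hxy
    (fun z hz => (hd z hz.1 hz.2).continuousAt.continuousWithinAt)
    (fun z hz => hd z hz.1.le hz.2.le)
  have hm := csc_sub_inv_monotoneOn ⟨hx.trans hz.1, hz.2.le.trans hy⟩ ⟨hx.trans hxy, hy⟩ hz.2.le
  have hyx : 0 < y - x := sub_pos.2 hxy
  rw [eq_div_iff hyx.ne'] at he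
  rw [← he]
  exact mul_le_mul_of_nonneg_right hm hyx.le

lemma cscPrimitive_pi_div_two : cscPrimitive (Real.pi / 2) = Real.log 2 - Real.log Real.pi := by
  rw [cscPrimitive, show Real.pi / 2 / 2 = Real.pi / 4 by ring, Real.sin_pi_div_four,
    Real.cos_pi_div_four, Real.log_div Real.pi_ne_zero two_ne_zero]
  ring

lemma cscPrimitive_le {h : ℝ} (h0 : 0 < h) (h1 : h ≤ Real.pi / 3) :
    cscPrimitive (h / 2) ≤ -Real.log 2 + 0.05 * h := by
  have hpi := Real.pi_lt_d6
  set y := h / 4 with hy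
  have hy0 : 0 < y := by positivity
  have hy1 : y ≤ 0.262 := by linarith
  have hc : 1 - y ^ 2 / 2 ≤ Real.cos y := Real.one_sub_sq_div_two_le_cos
  have hc0 : 0 < Real.cos y := by nlinarith
  have hs : Real.sin y ≤ y := Real.sin_le hy0.le
  have hs0 : 0 < Real.sin y := Real.sin_pos_of_pos_of_lt_pi hy0 (by linarith [Real.pi_gt_three])
  have e : h / 2 = 2 * y := by
    rw [hy]
    ring
  have h2 := Real.one_sub_inv_le_log_of_pos hc0
  have h3 : Real.log (Real.sin y) ≤ Real.log y := Real.log_le_log hs0 hs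
  have h4 : (Real.cos y)⁻¹ ≤ 1 + 0.2 * y := by
    rw [inv_le_iff_one_le_mul₀ hc0]
    nlinarith
  rw [cscPrimitive, e, show 2 * y / 2 = y by ring, Real.log_mul two_ne_zero hy0.ne']
  linarith

lemma log_succ_div_le {n : ℕ} (hn : 1 ≤ n) :
    Real.log ((n + 1 : ℝ) / n) ≤ 2 / (2 * n + 1) + (1 / (8 * n ^ 2) - 1 / (8 * (n + 1) ^ 2)) := by
  have hn' : (1 : ℝ) ≤ n := by exact_mod_cast hn
  have h0 : (0 : ℝ) < (n + 1) / n := by positivity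
  have h1 : 0 ≤ Real.log ((n + 1 : ℝ) / n) :=
    Real.log_nonneg (by rw [le_div_iff₀] <;> linarith)
  have h2 := Real.self_le_sinh_iff.2 h1
  rw [Real.sinh_log h0, inv_div] at h2
  refine h2.trans (sub_nonneg.1 ?_)
  have e : 2 / (2 * n + 1) + (1 / (8 * n ^ 2) - 1 / (8 * (n + 1) ^ 2)) -
      (((n + 1 : ℝ) / n) - n / (n + 1)) / 2 =
      1 / (8 * n ^ 2 * (n + 1) ^ 2 * (2 * n + 1)) := by
    field_simp
    ring
  rw [e]
  positivity

/-- The sums `∑_{j < n} 2 / (2 j + 1) - log n` decrease to `γ + 2 log 2 = 1.9635...`. -/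
lemma log_add_le_sum_odd {n : ℕ} (hn : 1 ≤ n) :
    Real.log n + 1.9621 ≤ ∑ j ∈ Finset.range n, 2 / (2 * (j : ℝ) + 1) := by
  set F : ℕ → ℝ := fun n => ∑ j ∈ Finset.range n, 2 / (2 * (j : ℝ) + 1) with hF
  have hF8 : 4.0436 ≤ F 8 := by
    rw [hF]
    norm_num [Finset.sum_range_succ]
  have hsucc : ∀ u : ℕ, F (u + 1) = F u + 2 / (2 * u + 1) := fun u => Finset.sum_range_succ _ _
  change Real.log n + 1.9621 ≤ F n
  clear_value F
  have hlog8 : Real.log (8 : ℕ) ≤ 2.07945 := by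
    have : ((8 : ℕ) : ℝ) = 2 ^ 3 := by norm_num
    rw [this, Real.log_pow]
    have := Real.log_two_lt_d9
    norm_num at this ⊢
    linarith
  have hanti : ∀ m u : ℕ, 1 ≤ m → m ≤ u → F u - Real.log u ≤ F m - Real.log m := by
    intro m u hm hmu
    induction u, hmu using Nat.le_induction with
    | base => rfl
    | succ u hu ih =>
      have hu' : (1 : ℝ) ≤ u := by exact_mod_cast hm.trans hu
      have h := le_log_div (a := (u + 1 : ℝ)) (b := u) (by linarith) (by linarith)
      rw [Real.log_div (by linarith) (by linarith),
        show 2 * ((u : ℝ) + 1 - u) / (u + 1 + u) = 2 / (2 * u + 1) by ring] at h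
      rw [hsucc u]
      push_cast
      linarith
  have hmono : ∀ u : ℕ, 8 ≤ u →
      F 8 - Real.log (8 : ℕ) - 1 / (8 * (8 : ℕ) ^ 2) ≤ F u - Real.log u - 1 / (8 * (u : ℝ) ^ 2) := by
    intro u hu
    induction u, hu using Nat.le_induction with
    | base => rfl
    | succ u hu ih =>
      have hu' : (8 : ℝ) ≤ u := by exact_mod_cast hu
      have h := log_succ_div_le (n := u) (by omega)
      rw [Real.log_div (by linarith) (by linarith)] at h
      rw [hsucc u]
      push_cast at ih ⊢
      linarith
  rcases le_total n 8 with h8 | h8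
  · have h := hanti n 8 hn h8
    push_cast at h hlog8
    linarith
  · have h := hmono n h8
    have h2 : 0 ≤ 1 / (8 * (n : ℝ) ^ 2) := by positivity
    have h3 : (1 : ℝ) / (8 * 8 ^ 2) ≤ 0.00196 := by norm_num
    push_cast at h hlog8
    linarith

lemma log_pi_le : Real.log Real.pi ≤ 1.1448 := by
  have h1 : Real.pi ^ 20 ≤ 2 ^ 33 * 1.022 :=
    (pow_le_pow_left₀ Real.pi_pos.le Real.pi_lt_d6.le 20).trans (by norm_num)
  have h2 := Real.log_le_log (by have := Real.pi_pos; positivity) h1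
  rw [Real.log_pow, Real.log_mul (by norm_num) (by norm_num), Real.log_pow] at h2
  have h3 := Real.log_le_sub_one_of_pos (x := 1.022) (by norm_num)
  have h4 := Real.log_two_lt_d9
  norm_num at h2 h3 h4 ⊢
  linarith

/-- The pole of `1 / sin` is split off; its contribution is a sum over odd numbers. The remainder
`1 / sin x - 1 / x` increases, so that its values bound the increments of the primitive. -/
lemma le_sum_csc_countAngle {n : ℕ} (hn : 1 ≤ n) :
    Real.log n + 2.2033 - 0.42 * (Real.pi / (2 * n + 1)) ≤ Real.pi / (2 * n + 1) *
      ∑ j ∈ Finset.range n, 1 / Real.sin (countAngle n j / 2) := by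
  have hpi := Real.pi_pos
  have hn' : (1 : ℝ) ≤ n := by exact_mod_cast hn
  set h := Real.pi / (2 * n + 1) with hh
  have h0 : 0 < h := by positivity
  have h3 : h ≤ Real.pi / 3 := by
    rw [hh]
    gcongr
    linarith
  have hx : ∀ j : ℕ, countAngle n j / 2 = (2 * j + 1) * h / 2 := by
    intro j
    rw [countAngle, hh]
    ring
  have hsum : ∀ m : ℕ, m + 1 ≤ n → ∑ j ∈ Finset.range (m + 1), 2 / (2 * (j : ℝ) + 1) +
      (cscPrimitive (countAngle n m / 2) - cscPrimitive (countAngle n 0 / 2)) ≤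
      h * ∑ j ∈ Finset.range (m + 1), 1 / Real.sin (countAngle n j / 2) := by
    intro m hm
    induction m with
    | zero =>
      have hs := sin_countAngle_half_pos (n := n) (j := 0) hm
      have hle := Real.sin_le (countAngle_half_pos n 0).le
      have e : 2 = h * (1 / (countAngle n 0 / 2)) := by
        rw [hx]
        push_cast
        field_simp
        norm_num
      simp only [zero_add, Finset.sum_range_one, Nat.cast_zero, mul_zero, div_one, sub_self,
        add_zero]
      refine e.le.trans ?_
      gcongr
    | succ m ih =>
      have h1 := cscPrimitive_sub_le (x := countAngle n m / 2) (y := countAngle n (m + 1) / 2)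
        (countAngle_half_pos n m) (by
          rw [hx, hx]
          push_cast
          linarith) (countAngle_half_le hm)
      have e1 : countAngle n (m + 1) / 2 - countAngle n m / 2 = h := by
        rw [hx, hx]
        push_cast
        ring
      have e2 : h * (1 / (countAngle n (m + 1) / 2)) = 2 / (2 * (m + 1 : ℕ) + 1) := by
        rw [hx]
        push_cast
        field_simp
      rw [e1, mul_comm, mul_sub, e2] at h1
      rw [Finset.sum_range_succ, Finset.sum_range_succ (fun j => 1 / Real.sin _), mul_add]
      linarith [ih (by omega)]
  obtain ⟨m, rfl⟩ : ∃ m, n = m + 1 := ⟨n - 1, by omega⟩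
  have hlast := hsum m le_rfl
  have hfirst := cscPrimitive_le h0 h3
  have e0 : countAngle (m + 1) 0 / 2 = h / 2 := by
    rw [hx]
    push_cast
    ring
  have em : Real.pi / 2 - countAngle (m + 1) m / 2 = h := by
    rw [countAngle, hh]
    push_cast
    field_simp
    ring
  have hend := cscPrimitive_sub_le (countAngle_half_pos (m + 1) m) (by linarith) le_rfl
  rw [em, Real.sin_pi_div_two, cscPrimitive_pi_div_two] at hend
  have h4 : (1 / 1 - 1 / (Real.pi / 2)) * h ≤ 0.37 * h := by
    gcongr
    have : 0.63 ≤ 1 / (Real.pi / 2) := by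
      rw [le_div_iff₀ (by positivity)]
      linarith [Real.pi_lt_d6]
    norm_num at this ⊢
    linarith
  have h5 := log_add_le_sum_odd hn
  have h6 := log_pi_le
  have h7 := Real.log_two_gt_d9
  rw [e0] at hlast
  linarith

lemma le_mean_singularValues {n : ℕ} (hn : 1 ≤ n) :
    0.701 + Real.log n / Real.pi ≤
      1 / n * ∑ j : Fin n, 1 / (2 * Real.sin (countAngle n j / 2)) := by
  have hpi := Real.pi_pos
  have hn' : (1 : ℝ) ≤ n := by exact_mod_cast hn
  have hlog : 0 ≤ Real.log n := Real.log_nonneg hn'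
  have h := le_sum_csc_countAngle hn
  rw [Fin.sum_univ_eq_sum_range fun j => 1 / (2 * Real.sin (countAngle n j / 2))]
  have e : ∑ j ∈ Finset.range n, 1 / (2 * Real.sin (countAngle n j / 2)) =
      1 / 2 * ∑ j ∈ Finset.range n, 1 / Real.sin (countAngle n j / 2) := by
    rw [Finset.mul_sum]
    refine Finset.sum_congr rfl fun j _ => ?_
    rw [div_mul_div_comm, one_mul]
  rw [e]
  set T := ∑ j ∈ Finset.range n, 1 / Real.sin (countAngle n j / 2)
  have h1 : (Real.log n + 2.2033) * (2 * n + 1) - 0.42 * Real.pi ≤ Real.pi * T := by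
    have h2 := mul_le_mul_of_nonneg_right h (by positivity : (0 : ℝ) ≤ 2 * n + 1)
    have e1 : (Real.log n + 2.2033 - 0.42 * (Real.pi / (2 * n + 1))) * (2 * n + 1) =
        (Real.log n + 2.2033) * (2 * n + 1) - 0.42 * Real.pi := by
      field_simp
    have e2 : Real.pi / (2 * n + 1) * T * (2 * n + 1) = Real.pi * T := by field_simp
    rwa [e1, e2] at h2
  have e3 : 0.701 + Real.log n / Real.pi = (0.701 * Real.pi + Real.log n) / Real.pi := by
    field_simp
  have e4 : 1 / n * (1 / 2 * T) = T / (2 * n) := by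
    field_simp
  rw [e3, e4, div_le_div_iff₀ hpi (by positivity)]
  have h8 : 0.701 * Real.pi ≤ 2.2033 := by linarith [Real.pi_lt_d6]
  have h9 : 0.701 * Real.pi * (2 * n) ≤ 2.2033 * (2 * n) := by gcongr
  nlinarith [Real.pi_lt_d6]

/-! ### Comparison of the bounds -/

lemma le_of_countMatrix_eq_mul {n k : ℕ} (hn : 1 ≤ n) {L : Matrix (Fin n) (Fin k) ℝ}
    {R : Matrix (Fin k) (Fin n) ℝ} (h : countMatrix n = L * R) :
    0.701 + Real.log n / Real.pi ≤ 1 / √(n : ℝ) * frobNorm L * opNorm 1 2 R := by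
  have hn' : (1 : ℝ) ≤ n := by exact_mod_cast hn
  have h0 : 0 < √(n : ℝ) := Real.sqrt_pos.2 (by linarith)
  have h1 := sum_le_frobNorm_mul_frobNorm (by positivity) (countSin_transpose_mul_self n)
    (countCos_transpose_mul_self n) (countMatrix_mul_countCos n) h
  have h2 := mul_le_mul_of_nonneg_left (frobNorm_le_sqrt_mul_opNorm_one_two R) (frobNorm_nonneg L)
  calc 0.701 + Real.log n / Real.pi
      ≤ 1 / n * ∑ j : Fin n, 1 / (2 * Real.sin (countAngle n j / 2)) := le_mean_singularValues hn
    _ ≤ 1 / n * (frobNorm L * (√n * opNorm 1 2 R)) := by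
        gcongr
        exact h1.trans h2
    _ = 1 / √(n : ℝ) * frobNorm L * opNorm 1 2 R := by
        nth_rewrite 1 [← Real.mul_self_sqrt (by linarith : (0 : ℝ) ≤ n)]
        field_simp

lemma frobNorm_mul_opNorm_le {n k : ℕ} (hn : 1 ≤ n) (L : Matrix (Fin n) (Fin k) ℝ)
    (R : Matrix (Fin k) (Fin n) ℝ) :
    1 / √(n : ℝ) * frobNorm L * opNorm 1 2 R ≤ opNorm 2 ∞ L * opNorm 1 2 R := by
  have h0 : 0 < √(n : ℝ) := Real.sqrt_pos.2 (by exact_mod_cast hn)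
  refine mul_le_mul_of_nonneg_right ?_ (opNorm_nonneg _ _ _)
  rw [one_div, inv_mul_le_iff₀ h0]
  exact frobNorm_le_sqrt_mul_opNorm_two_top L

/-- If `u ≤ v` from some index on, then `u ≤ v + ε` everywhere for some null sequence `ε`. -/
lemma exists_tendsto_zero_of_eventually_le {u v : ℕ → ℝ} (h : ∀ᶠ n in atTop, u n ≤ v n) :
    ∃ ε : ℕ → ℝ, Tendsto ε atTop (𝓝 0) ∧ ∀ n, u n ≤ v n + ε n := by
  refine ⟨fun n => max (u n - v n) 0, ?_, fun n => by linarith [le_max_left (u n - v n) 0]⟩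
  refine tendsto_const_nhds.congr' ?_
  filter_upwards [h] with n hn
  exact (max_eq_right (by linarith)).symm

theorem theorem1p1 :
    (∀ n : ℕ, sqrtMatrix n * sqrtMatrix n = countMatrix n ∧
      nsrLeft n * nsrRight n = countMatrix n) ∧
    ∃ ε δ : ℕ → ℝ, Tendsto ε atTop (𝓝 0) ∧ Tendsto δ atTop (𝓝 0) ∧
      ∀ n : ℕ, 1 ≤ n →
        (0.701 + Real.log n / Real.pi ≤ gammaTwo (countMatrix n) ∧
          gammaTwo (countMatrix n) ≤ opNorm 2 ∞ (nsrLeft n) * opNorm 1 2 (nsrRight n) ∧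
          opNorm 2 ∞ (nsrLeft n) * opNorm 1 2 (nsrRight n)
            ≤ 0.846 + Real.log n / Real.pi + ε n) ∧
        (0.701 + Real.log n / Real.pi ≤ gammaFrob (countMatrix n) ∧
          gammaFrob (countMatrix n)
            ≤ 1 / √(n : ℝ) * frobNorm (nsrLeft n) * opNorm 1 2 (nsrRight n) ∧
          1 / √(n : ℝ) * frobNorm (nsrLeft n) * opNorm 1 2 (nsrRight n)
            ≤ 0.748 + Real.log n / Real.pi + δ n) := by
  refine ⟨fun n => ⟨sqrtMatrix_mul_self n, nsrLeft_mul_nsrRight n⟩, ?_⟩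
  obtain ⟨ε, hε0, hε⟩ := exists_tendsto_zero_of_eventually_le eventually_opNorm_nsr_le
  obtain ⟨δ, hδ0, hδ⟩ := exists_tendsto_zero_of_eventually_le eventually_frobNorm_nsr_le
  refine ⟨ε, δ, hε0, hδ0, fun n hn => ⟨?_, ?_⟩⟩
  · have hlow : ∀ c ∈ {c : ℝ | ∃ (k : ℕ) (L : Matrix (Fin n) (Fin k) ℝ)
        (R : Matrix (Fin k) (Fin n) ℝ), countMatrix n = L * R ∧ c = opNorm 2 ∞ L * opNorm 1 2 R},
        0.701 + Real.log n / Real.pi ≤ c := by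
      rintro c ⟨k, L, R, h, rfl⟩
      exact (le_of_countMatrix_eq_mul hn h).trans (frobNorm_mul_opNorm_le hn L R)
    have hmem : ∃ (k : ℕ) (L : Matrix (Fin n) (Fin k) ℝ) (R : Matrix (Fin k) (Fin n) ℝ),
        countMatrix n = L * R ∧ opNorm 2 ∞ (nsrLeft n) * opNorm 1 2 (nsrRight n) =
          opNorm 2 ∞ L * opNorm 1 2 R :=
      ⟨n, nsrLeft n, nsrRight n, (nsrLeft_mul_nsrRight n).symm, rfl⟩
    exact ⟨le_csInf ⟨_, hmem⟩ hlow, csInf_le ⟨_, hlow⟩ hmem, hε n⟩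
  · have hlow : ∀ c ∈ {c : ℝ | ∃ (k : ℕ) (L : Matrix (Fin n) (Fin k) ℝ)
        (R : Matrix (Fin k) (Fin n) ℝ), countMatrix n = L * R ∧
          c = 1 / √(n : ℝ) * frobNorm L * opNorm 1 2 R},
        0.701 + Real.log n / Real.pi ≤ c := by
      rintro c ⟨k, L, R, h, rfl⟩
      exact le_of_countMatrix_eq_mul hn h
    have hmem : ∃ (k : ℕ) (L : Matrix (Fin n) (Fin k) ℝ) (R : Matrix (Fin k) (Fin n) ℝ),
        countMatrix n = L * R ∧
          1 / √(n : ℝ) * frobNorm (nsrLeft n) * opNorm 1 2 (nsrRight n) =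
          1 / √(n : ℝ) * frobNorm L * opNorm 1 2 R :=
      ⟨n, nsrLeft n, nsrRight n, (nsrLeft_mul_nsrRight n).symm, rfl⟩
    exact ⟨le_csInf ⟨_, hmem⟩ hlow, csInf_le ⟨_, hlow⟩ hmem, hδ n⟩
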